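/- Let $E_2,E_4,E_6$ be the normalized Eisenstein series on $\mathrm{SL}_2(\mathbb{Z})$ of weights $2,4,6$, and put $q=e^{2\pi i\tau}$. For $w\in\mathbb{Z}$ and $r\ge 0$ let $QM_w^{(r)}$ be the complex vector space of quasimodular forms of weight $w$ and depth $\le r$ on $\mathrm{SL}_2(\mathbb{Z})$, i.e. of all functions $\sum_{\ell=0}^{r}E_2^{\ell}f_\ell$ on the upper half-plane with $f_\ell$ a modular form of weight $w-2\ell$ on $\mathrm{SL}_2(\mathbb{Z})$. For even $w\ge 2$ with $w\neq 4$ let $G_w^{(1)}$ be the normalized extremal quasimodular form of weight $w$ and depth $1$, i.e. the form $f\in QM_w^{(1)}\setminus QM_w^{(0)}$ whose Fourier expansion is $f=q^{d-1}+O(q^{d})$ with $d=\dim_{\mathbb{C}}QM_w^{(1)}$; for $w=0$ and $w=4$, where no form of depth exactly $1$ exists, put $G_0^{(1)}=1$ and $G_4^{(1)}=E_4$. For $m\ge 1$ let $$N_{m,0}=24m\binom{6m}{2m}\binom{12m}{6m},\qquad N_{m,2}=\frac{12m+1}{12m-1}\,N_{m,0},$$ and for $m\ge 0$ let $$N_{m,6}=12(2m+1)\binom{6m+3}{2m+1}\binom{12m+6}{6m+3},\qquad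 N_{m,8}=\frac{12m+7}{12m+5}\,N_{m,6}.$$ For $m=0$ the quotients $\frac{N_{m,0}}{24m}$ and $\frac{N_{m,2}}{24m}$ are understood by cancelling the factor $24m$ first, so that for all $m\ge 0$ $$\frac{N_{m,0}}{24m}=\binom{6m}{2m}\binom{12m}{6m},\qquad \frac{N_{m,2}}{24m}=\frac{12m+1}{12m-1}\binom{6m}{2m}\binom{12m}{6m}.$$ **Theorem.** For every integer $m\ge 0$ the forms $G_{12m+a}^{(1)}$, $a\in\{0,2,4,6,8,10\}$, exist and are unique, and all Fourier coefficients of each of the following forms are integers: $$\frac{N_{m,0}}{24m}\,G_{12m}^{(1)},\quad \frac{N_{m,2}}{24m}\,G_{12m+2}^{(1)},\quad \frac{N_{m,6}}{12(2m+1)}\,G_{12m+6}^{(1)},\quad \frac{N_{m,8}}{12(2m+1)}\,G_{12m+8}^{(1)}.$$ Furthermore, $G_{12m+4}^{(1)}=E_4\,G_{12m}^{(1)}$ and $G_{12m+10}^{(1)}=E_4\,G_{12m+6}^{(1)}$, and all Fourier coefficients of $$\frac{N_{m,0}}{24m}\,G_{12m+4}^{(1)}\quad\text{and}\quad \frac{N_{m,6}}{12(2m+1)}\,G_{12m+10}^{(1)}$$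 are integers. -/

import Mathlib

open UpperHalfPlane
open scoped MatrixGroups

noncomputable section

namespace Quasimodular

/-- `QM w r` is the space $QM_w^{(r)}$ of quasimodular forms of weight `w` and depth `≤ r` on
`SL(2, ℤ)`: the sums $\sum_{\ell \le r} E_2^\ell f_\ell$ in which $f_\ell$ is a modular form of
weight $w - 2\ell$ on `SL(2, ℤ)`. -/
def QM (w : ℤ) (r : ℕ) : Submodule ℂ (ℍ → ℂ) :=
  Submodule.span ℂ
    {F | ∃ l : ℕ, l ≤ r ∧ ∃ f : ModularForm 𝒮ℒ (w - 2 * (l : ℤ)),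
      F = EisensteinSeries.E2 ^ l * (f : ℍ → ℂ)}

/-- `f` is a normalized extremal quasimodular form of weight `w` and depth exactly `r`:
its Fourier expansion is $q^{d-1} + O(q^d)$ where $d = \dim QM_w^{(r)}$. -/
structure IsNormalizedExtremal (w : ℤ) (r : ℕ) (f : ℍ → ℂ) : Prop where
  mem : f ∈ QM w r
  notMem : ∀ s < r, f ∉ QM w s
  order_add_one : (qExpansion 1 f).order + 1 = (Module.finrank ℂ (QM w r) : ℕ∞)
  leading : (qExpansion 1 f).coeff (Module.finrank ℂ (QM w r) - 1) = 1

/-- `IsG w f` says that `f` is the form $G_w^{(1)}$. There is no quasimodular form of weight `0`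
or `4` and depth exactly `1`; for these two weights, $G_0^{(1)} = 1$ and $G_4^{(1)} = E_4$. -/
def IsG (w : ℤ) (f : ℍ → ℂ) : Prop :=
  if w = 0 then f = 1
  else if w = 4 then f = (ModularForm.E₄ : ℍ → ℂ)
  else IsNormalizedExtremal w 1 f

/-- All Fourier coefficients of `f` (as a series in $q = e^{2 \pi i \tau}$) are integers. -/
def HasIntegralFourierCoeffs (f : ℍ → ℂ) : Prop :=
  ∀ n : ℕ, ∃ a : ℤ, (qExpansion 1 f).coeff n = (a : ℂ)

/-- $N_{m,0} = 24m \binom{6m}{2m} \binom{12m}{6m}$ for $m \ge 1$, and $N_{0,0} = 1$. -/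
def N0 (m : ℕ) : ℚ :=
  if m = 0 then 1 else 24 * m * (6 * m).choose (2 * m) * (12 * m).choose (6 * m)

/-- $N_{m,2} = \frac{12m+1}{12m-1} N_{m,0}$ for $m \ge 1$, and $N_{0,2} = 1$. -/
def N2 (m : ℕ) : ℚ :=
  if m = 0 then 1 else (12 * m + 1) / (12 * m - 1) * N0 m

/-- $N_{m,6} = 12(2m+1) \binom{6m+3}{2m+1} \binom{12m+6}{6m+3}$. -/
def N6 (m : ℕ) : ℚ :=
  12 * (2 * m + 1) * (6 * m + 3).choose (2 * m + 1) * (12 * m + 6).choose (6 * m + 3)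

/-- $N_{m,8} = \frac{12m+7}{12m+5} N_{m,6}$. -/
def N8 (m : ℕ) : ℚ :=
  (12 * m + 7) / (12 * m + 5) * N6 m

/-- The number $N_{m,0} / (24m)$, where for $m = 0$ the factor $24m$ is cancelled in the product
of binomial coefficients before $m = 0$ is substituted. -/
def N0div (m : ℕ) : ℚ :=
  (6 * m).choose (2 * m) * (12 * m).choose (6 * m)

/-- The number $N_{m,2} / (24m)$, where for $m = 0$ the factor $24m$ is cancelled in the product
of binomial coefficients before $m = 0$ is substituted. -/
def N2div (m : ℕ) : ℚ :=
  (12 * m + 1) / (12 * m - 1) * ((6 * m).choose (2 * m) * (12 * m).choose (6 * m))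

theorem N0div_eq {m : ℕ} (hm : m ≠ 0) : N0div m = N0 m / (24 * m) := by
  have h : (m : ℚ) ≠ 0 := by exact_mod_cast hm
  simp only [N0div, N0, if_neg hm]
  field_simp

theorem N2div_eq {m : ℕ} (hm : m ≠ 0) : N2div m = N2 m / (24 * m) := by
  have h : N2 m = (12 * m + 1) / (12 * m - 1) * N0 m := by simp only [N2, if_neg hm]
  rw [h, mul_div_assoc, ← N0div_eq hm, N0div, N2div]

end Quasimodular

end

noncomputable section

open Complex ModularForm EisensteinSeries Derivative
open scoped Manifold MatrixGroups ModularForm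

namespace Quasimodular

/-! Write weights as `6n`, `6n + 2`, `6n + 4`, with `n = 2m` or `n = 2m + 1`. A depth-one form of
weight `w` vanishing to order greater than `w / 6` is zero (`IsQuasimodular.eq_zero`). Since `QM w
1` has dimension `w / 6 + 1` for even `w ≥ 0`, extremal forms exist and are unique, and
multiplication by `E₄` carries the one of weight `6n` to that of weight `6n + 4`.

The same bound shows that the extremal form of weight `6n` is annihilated by the second order
operator `kanekoZagier n`, whose exponents at the cusp are `0` and `n`. In terms of `u = 1/j =
Δ/E₄³`, this equation is hypergeometric on the terms `E₄^((6n-1)/4) u^s` (`kanekoZagier_term`).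
Hence a multiple of the form is `∑ b_i E₄^((6n-1)/4) u^(n+i)`, with `b_i` given by a two-term
recursion. The fourth root of `E₄` and `u` have integral `q`-expansions, so it suffices that all
`b_i` are integers when `b_0` is the binomial product of the theorem. There `b_i` is a binomial
coefficient times `12^M ∏(12k+x) ∏(12k+y) / M!²`, which is integral by `sq_factorial_dvd`.

The form of weight `6n + 2` is proportional to the Serre derivative of the one of weight `6n`. This
multiplies `b_i` by `(12i+6n+1)/(6n-1)`, and integrality persists (`hypergeometricCoeff'_mul`). -/

/-- A holomorphic function on the upper half-plane that is a convergent power series in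
`q = exp (2 π i τ)`. -/
structure IsHolomorphicInQ (f : ℍ → ℂ) : Prop where
  periodic : Function.Periodic (f ∘ ofComplex) (1 : ℝ)
  mdiff : MDiff f
  bdd : IsBoundedAtImInfty f

/-! ### Functions holomorphic in `q`, and the `q`-expansion of their derivatives. -/

namespace IsHolomorphicInQ

variable {f g : ℍ → ℂ}

theorem analyticAt (hf : IsHolomorphicInQ f) : AnalyticAt ℂ (cuspFunction 1 f) 0 :=
  analyticAt_cuspFunction_zero one_pos hf.periodic hf.mdiff hf.bdd

theorem add (hf : IsHolomorphicInQ f) (hg : IsHolomorphicInQ g) : IsHolomorphicInQ (f + g) where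
  periodic := hf.periodic.add hg.periodic
  mdiff := hf.mdiff.add hg.mdiff
  bdd := hf.bdd.add hg.bdd

theorem mul (hf : IsHolomorphicInQ f) (hg : IsHolomorphicInQ g) : IsHolomorphicInQ (f * g) where
  periodic := hf.periodic.mul hg.periodic
  mdiff := hf.mdiff.mul hg.mdiff
  bdd := hf.bdd.mul hg.bdd

theorem smul (c : ℂ) (hf : IsHolomorphicInQ f) : IsHolomorphicInQ (c • f) where
  periodic := by
    intro z
    simpa using congrArg (c * ·) (hf.periodic z)
  mdiff := hf.mdiff.const_smul c
  bdd := hf.bdd.smul c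

theorem neg (hf : IsHolomorphicInQ f) : IsHolomorphicInQ (-f) := by
  simpa using hf.smul (-1)

theorem sub (hf : IsHolomorphicInQ f) (hg : IsHolomorphicInQ g) : IsHolomorphicInQ (f - g) := by
  simpa [sub_eq_add_neg] using hf.add hg.neg

theorem modularForm {k : ℤ} (f : ModularForm 𝒮ℒ k) : IsHolomorphicInQ f where
  periodic := SlashInvariantFormClass.periodic_comp_ofComplex f one_mem_strictPeriods_SL
  mdiff := f.holo'
  bdd :=
    have : Fact (IsCusp OnePoint.infty 𝒮ℒ) :=
      ⟨Subgroup.isCusp_of_mem_strictPeriods one_pos one_mem_strictPeriods_SL⟩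
    ModularFormClass.bdd_at_infty f

theorem E2 : IsHolomorphicInQ E2 where
  periodic := by
    intro w
    by_cases hw : 0 < im w
    · have h1 : 0 < im (w + (1 : ℝ)) := by simpa using hw
      have h := congrFun (E2_slash_action ModularGroup.T) ⟨w, hw⟩
      rw [D2_T, smul_zero, sub_zero, SL_slash_apply] at h
      simp only [Function.comp_apply, ofComplex_apply_of_im_pos h1, ofComplex_apply_of_im_pos hw]
      rw [← h, modular_T_smul]
      have : (⟨w + (1 : ℝ), h1⟩ : ℍ) = (1 : ℝ) +ᵥ (⟨w, hw⟩ : ℍ) := by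
        ext
        simp [add_comm]
      rw [this, ModularGroup.denom_apply]
      simp [ModularGroup.T]
    -- Outside the upper half-plane `ofComplex` takes a constant default value, so periodicity is
    -- automatic.
    · have h1 : im (w + (1 : ℝ)) ≤ 0 := by simpa using hw
      simp only [Function.comp_apply, ofComplex_apply_of_im_nonpos h1,
        ofComplex_apply_of_im_nonpos (not_lt.mp hw)]
  mdiff := E2_mdifferentiable
  bdd := isBoundedAtImInfty_E2

theorem coeff_eq_of_hasSum (hf : IsHolomorphicInQ f) {c : ℕ → ℂ}
    (h : ∀ τ : ℍ, HasSum (fun m ↦ c m • Function.Periodic.qParam 1 τ ^ m) (f τ)) (m : ℕ) :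
    c m = (qExpansion 1 f).coeff m := by
  have h1 := (hasFPowerSeriesOnBall_cuspFunction one_pos hf.analyticAt h).hasFPowerSeriesAt
  have h2 := hf.analyticAt.hasFPowerSeriesAt
  have h3 := congrArg (FormalMultilinearSeries.coeff · m) (h1.eq_formalMultilinearSeries h2)
  rw [qExpansion_coeff]
  simpa [FormalMultilinearSeries.coeff_ofScalars, div_eq_mul_inv, mul_comm] using h3

theorem hasSum_normalizedDeriv (hf : IsHolomorphicInQ f) (τ : ℍ) :
    HasSum (fun m : ℕ ↦ ((m : ℂ) * (qExpansion 1 f).coeff m) •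
      Function.Periodic.qParam 1 τ ^ m) (D f τ) := by
  set F := cuspFunction 1 f with hF
  set q := Function.Periodic.qParam 1 τ with hq
  have hq1 : ‖q‖ < 1 := Function.Periodic.norm_qParam_lt_one one_pos τ.im_pos
  have hdiff : DifferentiableOn ℂ F (Metric.ball 0 1) :=
    differentiableOn_cuspFunction_ball one_pos hf.periodic hf.mdiff hf.bdd
  have hd : D f τ = q * deriv F q := by
    have h1 : (f ∘ ofComplex) =ᶠ[nhds (τ : ℂ)] F ∘ Function.Periodic.qParam 1 := by
      filter_upwards [isOpen_upperHalfPlaneSet.mem_nhds τ.im_pos] with w hw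
      have := eq_cuspFunction (h := 1) (f := f) ⟨w, hw⟩ one_ne_zero hf.periodic
      simp only [Function.comp_apply, ofComplex_apply_of_im_pos hw, hF]
      exact this.symm
    have h2 : HasDerivAt (Function.Periodic.qParam 1) (2 * Real.pi * Complex.I * q) (τ : ℂ) := by
      have : HasDerivAt (fun z : ℂ ↦ 2 * Real.pi * Complex.I * z / (1 : ℝ))
          (2 * Real.pi * Complex.I) (τ : ℂ) := by
        simpa using (hasDerivAt_id (τ : ℂ)).const_mul (2 * Real.pi * Complex.I)
      change HasDerivAt (fun z : ℂ ↦ cexp (2 * Real.pi * Complex.I * z / (1 : ℝ))) _ _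
      exact this.cexp.congr_deriv (mul_comm _ _)
    have h3 : HasDerivAt F (deriv F q) q :=
      (hdiff.differentiableAt (Metric.isOpen_ball.mem_nhds (by simpa using hq1))).hasDerivAt
    have h4 := (h3.comp (τ : ℂ) h2).congr_of_eventuallyEq h1
    rw [normalizedDerivOfComplex, h4.deriv]
    field_simp [Real.pi_ne_zero]
  have hs := (hasSum_taylorSeries_on_ball (hdiff.deriv Metric.isOpen_ball) (z := q)
    (by simpa using hq1)).mul_left q
  rw [hd, ← hasSum_nat_add_iff' 1]
  simp only [Finset.range_one, Finset.sum_singleton, Nat.cast_zero, zero_mul, zero_smul, sub_zero]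
  refine (congrArg (HasSum · (q * deriv F q)) (funext fun m ↦ ?_)).mp hs
  rw [qExpansion_coeff, ← hF, iteratedDeriv_succ', Nat.factorial_succ]
  have h1 : ((m : ℂ) + 1) ≠ 0 := by exact_mod_cast m.succ_ne_zero
  have h2 : (m.factorial : ℂ) ≠ 0 := by exact_mod_cast m.factorial_ne_zero
  simp only [smul_eq_mul, Nat.cast_mul, Nat.cast_add, Nat.cast_one, sub_zero]
  field_simp
  ring

theorem normalizedDeriv (hf : IsHolomorphicInQ f) : IsHolomorphicInQ (D f) where
  periodic := by
    intro w
    simp only [Function.comp_apply]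
    by_cases hw : 0 < im w
    · have h1 : 0 < im (w + (1 : ℝ)) := by simpa using hw
      rw [ofComplex_apply_of_im_pos h1, ofComplex_apply_of_im_pos hw]
      simp only [normalizedDerivOfComplex]
      congr 1
      rw [← deriv_comp_add_const]
      congr 1
      ext z
      exact hf.periodic z
    · have h1 : im (w + (1 : ℝ)) ≤ 0 := by simpa using hw
      rw [ofComplex_apply_of_im_nonpos h1, ofComplex_apply_of_im_nonpos (not_lt.mp hw)]
  mdiff := normalizedDerivOfComplex_mdifferentiable hf.mdiff
  bdd := isBoundedAtImInfty_of_hasSum_qExpansion one_pos hf.hasSum_normalizedDeriv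

theorem qExpansion_normalizedDeriv (hf : IsHolomorphicInQ f) :
    qExpansion 1 (D f) = PowerSeries.X * PowerSeries.derivative ℂ (qExpansion 1 f) := by
  ext m
  have h := hf.normalizedDeriv.coeff_eq_of_hasSum (fun τ ↦ hf.hasSum_normalizedDeriv τ) m
  rw [← h]
  cases m with
  | zero => simp
  | succ m =>
    rw [PowerSeries.coeff_succ_X_mul, PowerSeries.coeff_derivative, mul_comm]
    push_cast
    rfl

end IsHolomorphicInQ

/-! ### Modularity of Serre derivatives. -/

/-- A holomorphic function in `q` that is invariant under the weight `k` action of `SL(2, ℤ)` is a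
modular form. -/
def modularFormOfInvariant {k : ℤ} (f : ℍ → ℂ) (hf : IsHolomorphicInQ f)
    (h : ∀ γ : SL(2, ℤ), f ∣[k] γ = f) : ModularForm 𝒮ℒ k where
  toFun := f
  slash_action_eq' := fun _ ⟨γ, hγ⟩ ↦ hγ ▸ h γ
  holo' := hf.mdiff
  bdd_at_cusps' {c} hc := by
    rw [Subgroup.IsArithmetic.isCusp_iff_isCusp_SL2Z] at hc
    rw [OnePoint.isBoundedAt_iff_forall_SL2Z hc]
    intro γ _
    rw [h γ]
    exact hf.bdd

theorem isHolomorphicInQ_serreDerivative {f : ℍ → ℂ} (k : ℂ) (hf : IsHolomorphicInQ f) :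
    IsHolomorphicInQ (serreDerivative k f) := by
  have : serreDerivative k f = D f - (k * 12⁻¹) • (EisensteinSeries.E2 * f) := by
    ext z
    simp [mul_assoc]
  rw [this]
  exact hf.normalizedDeriv.sub ((IsHolomorphicInQ.E2.mul hf).smul _)

theorem exists_modularForm_eq_serreDerivative {k : ℤ} (f : ModularForm 𝒮ℒ k) :
    ∃ g : ModularForm 𝒮ℒ (k + 2), (g : ℍ → ℂ) = serreDerivative k f :=
  ⟨modularFormOfInvariant (serreDerivative k f)
    (isHolomorphicInQ_serreDerivative k (.modularForm f)) fun γ ↦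
      serreDerivative_slash_invariant f.holo'
        (SlashInvariantForm.slash_action_eqn f.toSlashInvariantForm _ ⟨γ, rfl⟩), rfl⟩

/-- Under `S` the anomalous terms of `D E2` and of `E2² / 12` cancel, and under `T` there are none.
These two generators suffice. -/
theorem exists_modularForm_eq_normalizedDeriv_E2 :
    ∃ g : ModularForm 𝒮ℒ 4, (g : ℍ → ℂ) = D EisensteinSeries.E2 -
      (12⁻¹ : ℂ) • (EisensteinSeries.E2 * EisensteinSeries.E2) := by
  have hE := IsHolomorphicInQ.E2
  refine ⟨modularFormOfInvariant _ (hE.normalizedDeriv.sub ((hE.mul hE).smul _))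
    (SlashInvariantForm.slash_action_generators_SL2Z ?_ ?_), rfl⟩
  · have hS := E2_slash_action ModularGroup.S
    have hD := normalizedDerivOfComplex_SL_slash (k := 2) hE.mdiff (γ := ModularGroup.S)
    have hm := ModularForm.mul_slash_SL2 2 2 ModularGroup.S EisensteinSeries.E2 EisensteinSeries.E2
    have hD2 : MDiff (D2 ModularGroup.S) := by
      rw [UpperHalfPlane.mdifferentiable_iff]
      have : DifferentiableOn ℂ (fun z : ℂ ↦ 2 * Real.pi * Complex.I / z) upperHalfPlaneSet := by
        intro z hz
        have hz0 : z ≠ 0 := fun h ↦ by simp [h, upperHalfPlaneSet] at hz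
        exact ((differentiableAt_const _).div differentiableAt_id hz0).differentiableWithinAt
      refine this.congr fun z hz ↦ ?_
      simp [D2_S, ofComplex_apply_of_im_pos hz]
    have hDD2 (z : ℍ) : D (D2 ModularGroup.S) z = -1 / (z : ℂ) ^ 2 := by
      have h1 : D2 ModularGroup.S ∘ ofComplex =ᶠ[nhds (z : ℂ)]
          fun w ↦ 2 * Real.pi * Complex.I / w := by
        filter_upwards [isOpen_upperHalfPlaneSet.mem_nhds z.im_pos] with w hw
        simp [D2_S, ofComplex_apply_of_im_pos hw]
      have h2 : HasDerivAt (fun w : ℂ ↦ 2 * Real.pi * Complex.I / w)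
          (2 * Real.pi * Complex.I * -((z : ℂ) ^ 2)⁻¹) z := by
        simpa [div_eq_mul_inv] using
          (hasDerivAt_inv (ne_zero z)).const_mul (2 * Real.pi * Complex.I)
      rw [normalizedDerivOfComplex, (h2.congr_of_eventuallyEq h1).deriv]
      field_simp [Real.pi_ne_zero]
    rw [hS, normalizedDerivOfComplex_sub _ _ hE.mdiff (hD2.const_smul _),
      normalizedDerivOfComplex_smul _ _ hD2] at hD
    ext z
    have hDz := congrFun hD z
    have hmz := congrFun hm z
    rw [hS] at hmz
    have hπ : (Real.pi : ℂ) ≠ 0 := by exact_mod_cast Real.pi_ne_zero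
    rw [sub_eq_add_neg, SlashAction.add_slash, SlashAction.neg_slash, SL_smul_slash]
    simp only [Pi.sub_apply, Pi.add_apply, Pi.neg_apply, Pi.smul_apply, Pi.mul_apply, smul_eq_mul,
      D2_S, hDD2, riemannZeta_two, ModularGroup.denom_S] at hDz hmz ⊢
    have hc : ((ModularGroup.S 1 0 : ℤ) : ℂ) = 1 := by simp [ModularGroup.S]
    have hz := ne_zero z
    change (D EisensteinSeries.E2 ∣[(2 + 2 : ℤ)] ModularGroup.S) z + -(12⁻¹ *
      ((EisensteinSeries.E2 * EisensteinSeries.E2) ∣[(2 + 2 : ℤ)] ModularGroup.S) z) = _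
    rw [hc] at hDz
    rw [hmz, ← sub_eq_zero]
    have hI : Complex.I ≠ 0 := Complex.I_ne_zero
    field_simp at hDz ⊢
    ring_nf at hDz ⊢
    simp only [Complex.I_sq] at hDz ⊢
    linear_combination 6 * Complex.I * hDz - (12 * (D EisensteinSeries.E2 z * Real.pi ^ 2 * z ^ 2) -
      12 * (Real.pi ^ 2 * z ^ 2 * (D EisensteinSeries.E2 ∣[(4 : ℤ)] ModularGroup.S) z) - 36) *
      Complex.I_sq
  · have hT := E2_slash_action ModularGroup.T
    have hD := normalizedDerivOfComplex_SL_slash (k := 2) hE.mdiff (γ := ModularGroup.T)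
    have hm := ModularForm.mul_slash_SL2 2 2 ModularGroup.T EisensteinSeries.E2 EisensteinSeries.E2
    rw [D2_T, smul_zero, sub_zero] at hT
    rw [hT] at hm hD
    rw [← sub_eq_zero, sub_eq_iff_eq_add, zero_add] at hD
    rw [sub_eq_add_neg, SlashAction.add_slash, SlashAction.neg_slash, SL_smul_slash]
    have hD' : D EisensteinSeries.E2 ∣[(4 : ℤ)] ModularGroup.T = D EisensteinSeries.E2 := by
      conv_rhs => rw [hD]
      ext z
      simp
    rw [hD']
    exact congrArg (fun x ↦ D EisensteinSeries.E2 + -((12⁻¹ : ℂ) • x)) hm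

/-! ### Power series form of the theory and Ramanujan's identities. -/

open PowerSeries in
/-- The derivation `q d/dq` on power series in `q`. -/
def theta : Derivation ℂ ℂ⟦X⟧ ℂ⟦X⟧ := (X : ℂ⟦X⟧) • PowerSeries.derivative ℂ

/-- The `q`-expansion of `E₂`. -/
def e2 : PowerSeries ℂ := qExpansion 1 EisensteinSeries.E2

/-- The `q`-expansion of `E₄`. -/
def e4 : PowerSeries ℂ := qExpansion 1 E₄

/-- The `q`-expansion of `E₆`. -/
def e6 : PowerSeries ℂ := qExpansion 1 E₆

/-- The power series `s` is the `q`-expansion of a modular form of weight `k`. -/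
def IsModular (k : ℤ) (s : PowerSeries ℂ) : Prop :=
  ∃ f : ModularForm 𝒮ℒ k, qExpansion 1 f = s

/-- Twelve times the Serre derivative of weight `k`. -/
def serreTheta (k : ℤ) (s : PowerSeries ℂ) : PowerSeries ℂ :=
  12 * theta s - (k : PowerSeries ℂ) * e2 * s

theorem coeff_theta (s : PowerSeries ℂ) (n : ℕ) :
    (theta s).coeff n = n * s.coeff n := by
  cases n with
  | zero => simp [theta]
  | succ n =>
    simp only [theta, Derivation.smul_apply, smul_eq_mul]
    rw [PowerSeries.coeff_succ_X_mul, PowerSeries.coeff_derivative, mul_comm]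
    push_cast
    rfl

theorem theta_mul (s t : PowerSeries ℂ) : theta (s * t) = s * theta t + t * theta s := by
  simp [Derivation.leibniz]

theorem theta_pow (s : PowerSeries ℂ) (n : ℕ) :
    theta (s ^ n) = (n : PowerSeries ℂ) * s ^ (n - 1) * theta s := by
  simp [Derivation.leibniz_pow, mul_assoc]

theorem theta_X_pow_mul (n : ℕ) (s : PowerSeries ℂ) :
    theta (PowerSeries.X ^ n * s) = PowerSeries.X ^ n * ((n : PowerSeries ℂ) * s + theta s) := by
  ext i
  rw [coeff_theta, PowerSeries.coeff_X_pow_mul', PowerSeries.coeff_X_pow_mul']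
  split_ifs with h
  · obtain ⟨j, rfl⟩ := Nat.exists_eq_add_of_le h
    have : ((n : PowerSeries ℂ) * s).coeff j = n * s.coeff j := by
      rw [← nsmul_eq_mul, map_nsmul, nsmul_eq_mul]
    simp only [Nat.add_sub_cancel_left, map_add, coeff_theta, this]
    push_cast
    ring
  · simp

theorem constantCoeff_theta (s : PowerSeries ℂ) : (theta s).constantCoeff = 0 := by
  rw [← PowerSeries.coeff_zero_eq_constantCoeff_apply, coeff_theta]
  simp

theorem constantCoeff_ofNat (n : ℕ) [n.AtLeastTwo] :
    (OfNat.ofNat n : PowerSeries ℂ).constantCoeff = OfNat.ofNat n :=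
  map_ofNat _ n

theorem ofNat_ne_zero (n : ℕ) [n.AtLeastTwo] : (OfNat.ofNat n : PowerSeries ℂ) ≠ 0 := fun h ↦
  OfNat.ofNat_ne_zero (R := ℂ) n
    ((constantCoeff_ofNat n).symm.trans ((congrArg PowerSeries.constantCoeff h).trans (map_zero _)))

namespace IsModular

variable {k l : ℤ} {s t : PowerSeries ℂ}

theorem add (hs : IsModular k s) (ht : IsModular k t) : IsModular k (s + t) := by
  obtain ⟨f, rfl⟩ := hs
  obtain ⟨g, rfl⟩ := ht
  exact ⟨f + g, ModularForm.qExpansion_add one_pos one_mem_strictPeriods_SL f g⟩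

theorem smul (c : ℂ) (hs : IsModular k s) : IsModular k (c • s) := by
  obtain ⟨f, rfl⟩ := hs
  exact ⟨c • f, ModularForm.qExpansion_smul one_pos one_mem_strictPeriods_SL c f⟩

theorem intCast_mul (c : ℤ) (hs : IsModular k s) : IsModular k (c * s) := by
  have := hs.smul (c : ℂ)
  rwa [Int.cast_smul_eq_zsmul, zsmul_eq_mul] at this

theorem sub (hs : IsModular k s) (ht : IsModular k t) : IsModular k (s - t) := by
  have := hs.add (ht.intCast_mul (-1))
  simpa [sub_eq_add_neg] using this

theorem mul (hs : IsModular k s) (ht : IsModular l t) : IsModular (k + l) (s * t) := by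
  obtain ⟨f, rfl⟩ := hs
  obtain ⟨g, rfl⟩ := ht
  exact ⟨f.mul g, ModularForm.qExpansion_mul one_pos one_mem_strictPeriods_SL f g⟩

theorem cast (hs : IsModular k s) (h : k = l) : IsModular l s := h ▸ hs

theorem serreTheta (hs : IsModular k s) : IsModular (k + 2) (serreTheta k s) := by
  obtain ⟨f, rfl⟩ := hs
  obtain ⟨g, hg⟩ := exists_modularForm_eq_serreDerivative f
  have hf := IsHolomorphicInQ.modularForm f
  have h2 := IsHolomorphicInQ.E2
  have h : ((12 : ℂ) • g : ℍ → ℂ) = (12 : ℂ) • D f - (k : ℂ) • (EisensteinSeries.E2 * f) := by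
    rw [hg]
    ext z
    simp only [serreDerivative_apply, Pi.smul_apply, Pi.sub_apply, Pi.mul_apply, smul_eq_mul]
    ring
  refine ⟨(12 : ℂ) • g, ?_⟩
  change qExpansion 1 ((12 : ℂ) • g : ℍ → ℂ) = _
  rw [h, qExpansion_sub (hf.normalizedDeriv.smul _).analyticAt ((h2.mul hf).smul _).analyticAt,
    qExpansion_smul hf.normalizedDeriv.analyticAt, qExpansion_smul (h2.mul hf).analyticAt,
    qExpansion_mul h2.analyticAt hf.analyticAt, hf.qExpansion_normalizedDeriv,
    Int.cast_smul_eq_zsmul, zsmul_eq_mul, Quasimodular.serreTheta, e2, mul_assoc,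
    ← Nat.cast_ofNat (n := 12), Nat.cast_smul_eq_nsmul, nsmul_eq_mul]
  rfl

theorem eq_zero (hs : IsModular k s) (h : ∀ i ≤ k.toNat / 12, s.coeff i = 0) : s = 0 := by
  obtain ⟨f, rfl⟩ := hs
  have : f = 0 := by
    refine ModularForm.sturm_bound_levelOne ?_
    refine lt_of_lt_of_le ?_ (PowerSeries.nat_le_order _ (k.toNat / 12 + 1)
      fun i hi ↦ h i (Nat.lt_succ_iff.mp hi))
    exact_mod_cast Nat.lt_succ_self _
  rw [this]
  exact qExpansion_zero 1

end IsModular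

theorem isModular_e4 : IsModular 4 e4 := ⟨E₄, rfl⟩

theorem isModular_e6 : IsModular 6 e6 := ⟨E₆, rfl⟩

theorem coeff_e2 (n : ℕ) :
    e2.coeff n = if n = 0 then 1 else -24 * (ArithmeticFunction.sigma 1 n : ℂ) := by
  refine (IsHolomorphicInQ.E2.coeff_eq_of_hasSum (c := fun n ↦ if n = 0 then 1 else
    -24 * (ArithmeticFunction.sigma 1 n : ℂ)) (fun τ ↦ ?_) n).symm
  simpa only [Function.Periodic.qParam, ofReal_one, div_one] using hasSum_qExpansion_E2 (z := τ)

theorem coeff_e4 (n : ℕ) :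
    e4.coeff n = if n = 0 then 1 else 240 * (ArithmeticFunction.sigma 3 n : ℂ) := by
  rw [e4, E_qExpansion_coeff _ ⟨2, rfl⟩]
  norm_num [show bernoulli 4 = -1 / 30 by decide +kernel]

theorem coeff_e6 (n : ℕ) :
    e6.coeff n = if n = 0 then 1 else -504 * (ArithmeticFunction.sigma 5 n : ℂ) := by
  rw [e6, E_qExpansion_coeff _ ⟨3, rfl⟩]
  norm_num [show bernoulli 6 = 1 / 42 by decide +kernel]

theorem constantCoeff_e2 : e2.constantCoeff = 1 := by
  simpa using coeff_e2 0

theorem constantCoeff_e4 : e4.constantCoeff = 1 := by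
  simpa using coeff_e4 0

theorem constantCoeff_e6 : e6.constantCoeff = 1 := by
  simpa using coeff_e6 0

/-- In weights below 12 the Sturm bound sees only the constant term, so each of Ramanujan's three
identities reduces to comparing constant terms of modular forms. -/
theorem theta_e4 : 3 * theta e4 = e2 * e4 - e6 := by
  have h : IsModular 6 (serreTheta 4 e4 + (4 : ℤ) * e6) :=
    (isModular_e4.serreTheta.cast (by norm_num)).add (isModular_e6.intCast_mul 4)
  have h0 := h.eq_zero fun i hi ↦ by
    obtain rfl : i = 0 := by simpa using hi
    simp [serreTheta, constantCoeff_theta, constantCoeff_e2, constantCoeff_e4, constantCoeff_e6]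
  rw [serreTheta] at h0
  push_cast at h0
  have h4 : (4 : PowerSeries ℂ) ≠ 0 := ofNat_ne_zero 4
  exact mul_left_cancel₀ h4 (by linear_combination h0)

theorem theta_e6 : 2 * theta e6 = e2 * e6 - e4 ^ 2 := by
  have h : IsModular 8 (serreTheta 6 e6 + (6 : ℤ) * (e4 * e4)) :=
    (isModular_e6.serreTheta.cast (by norm_num)).add
      (((isModular_e4.mul isModular_e4).cast (by norm_num)).intCast_mul 6)
  have h0 := h.eq_zero fun i hi ↦ by
    obtain rfl : i = 0 := by simpa using hi
    simp [serreTheta, constantCoeff_theta, constantCoeff_e2, constantCoeff_e4, constantCoeff_e6]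
  rw [serreTheta] at h0
  push_cast at h0
  have h6 : (6 : PowerSeries ℂ) ≠ 0 := ofNat_ne_zero 6
  exact mul_left_cancel₀ h6 (by linear_combination h0)

theorem isModular_theta_e2 : IsModular 4 (12 * theta e2 - e2 * e2) := by
  obtain ⟨g, hg⟩ := exists_modularForm_eq_normalizedDeriv_E2
  have h2 := IsHolomorphicInQ.E2
  have h : qExpansion 1 g = theta e2 - (12⁻¹ : ℂ) • (e2 * e2) := by
    rw [hg, qExpansion_sub h2.normalizedDeriv.analyticAt ((h2.mul h2).smul _).analyticAt,
      qExpansion_smul (h2.mul h2).analyticAt, qExpansion_mul h2.analyticAt h2.analyticAt,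
      h2.qExpansion_normalizedDeriv]
    rfl
  have h12 := IsModular.smul 12 ⟨g, h⟩
  rw [smul_sub, smul_smul, mul_inv_cancel₀ (by norm_num), one_smul, ← Nat.cast_ofNat (n := 12),
    Nat.cast_smul_eq_nsmul, nsmul_eq_mul] at h12
  exact h12

theorem theta_e2 : 12 * theta e2 = e2 ^ 2 - e4 := by
  have h0 := (isModular_theta_e2.add isModular_e4).eq_zero fun i hi ↦ by
    obtain rfl : i = 0 := by simpa using hi
    simp [constantCoeff_theta, constantCoeff_e2, constantCoeff_e4]
  linear_combination h0

/-! ### Depth-one quasimodular series and their vanishing bound. -/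

/-- The power series `s` is the `q`-expansion of a quasimodular form of weight `w` and depth at
most one. -/
def IsQuasimodular (w : ℤ) (s : PowerSeries ℂ) : Prop :=
  ∃ a b, IsModular w a ∧ IsModular (w - 2) b ∧ s = a + e2 * b

namespace IsQuasimodular

variable {w : ℤ} {s t : PowerSeries ℂ}

theorem sub (hs : IsQuasimodular w s) (ht : IsQuasimodular w t) : IsQuasimodular w (s - t) := by
  obtain ⟨a, b, ha, hb, rfl⟩ := hs
  obtain ⟨c, d, hc, hd, rfl⟩ := ht
  exact ⟨a - c, b - d, ha.sub hc, hb.sub hd, by ring⟩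

theorem smul (c : ℂ) (hs : IsQuasimodular w s) : IsQuasimodular w (c • s) := by
  obtain ⟨a, b, ha, hb, rfl⟩ := hs
  exact ⟨c • a, c • b, ha.smul c, hb.smul c, by rw [smul_add, mul_smul_comm]⟩

theorem intCast_mul (c : ℤ) (hs : IsQuasimodular w s) : IsQuasimodular w (c * s) := by
  have := hs.smul (c : ℂ)
  rwa [Int.cast_smul_eq_zsmul, zsmul_eq_mul] at this

theorem cast {v : ℤ} (hs : IsQuasimodular w s) (h : w = v) : IsQuasimodular v s := h ▸ hs

theorem modular_mul {k : ℤ} {m : PowerSeries ℂ} (hm : IsModular k m) (hs : IsQuasimodular w s) :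
    IsQuasimodular (k + w) (m * s) := by
  obtain ⟨a, b, ha, hb, rfl⟩ := hs
  exact ⟨m * a, m * b, hm.mul ha, (hm.mul hb).cast (by ring), by ring⟩

/-- With `w - 1` in place of `w` the `e2 ^ 2` contributions cancel, so the depth does not grow. -/
theorem serreTheta (hs : IsQuasimodular w s) : IsQuasimodular (w + 2) (serreTheta (w - 1) s) := by
  obtain ⟨a, b, ha, hb, rfl⟩ := hs
  refine ⟨Quasimodular.serreTheta w a - e4 * b, Quasimodular.serreTheta (w - 2) b + a,
    ha.serreTheta.sub ((isModular_e4.mul hb).cast (by ring)),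
    (hb.serreTheta.cast (by ring)).add (ha.cast (by ring)), ?_⟩
  simp only [Quasimodular.serreTheta, map_add, theta_mul]
  push_cast
  linear_combination b * theta_e2

theorem exists_eq_X_pow_mul {f : PowerSeries ℂ} (hf : f ≠ 0) :
    ∃ (n : ℕ) (g : PowerSeries ℂ), g.constantCoeff ≠ 0 ∧ f = PowerSeries.X ^ n * g := by
  obtain ⟨g, hg⟩ := PowerSeries.X_pow_order_dvd (φ := f)
  refine ⟨f.order.toNat, g, fun h0 ↦ ?_, hg⟩
  have h1 := PowerSeries.coeff_order hf
  rw [hg, PowerSeries.coeff_X_pow_mul', ← hg, if_pos le_rfl, Nat.sub_self] at h1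
  exact h1 (by simpa using h0)

/-- If `f` and `b` have orders `m` and `n`, the right side starts with a multiple of `12 (m - n) q ^
(m + n)`, the left side with `q ^ (2m)`. These orders disagree whether `m < n`, `m = n` (the bracket
then loses its leading term) or `m > n`. -/
theorem eq_zero_of_sq_eq {f b : PowerSeries ℂ} (h : f ^ 2 = 12 * (b * theta f - f * theta b)) :
    f = 0 := by
  by_contra hf
  have hb : b ≠ 0 := by
    rintro rfl
    simp only [zero_mul, map_zero, mul_zero, sub_zero] at h
    exact hf (pow_eq_zero_iff two_ne_zero |>.mp h)
  obtain ⟨m, f, hf0, rfl⟩ := exists_eq_X_pow_mul hf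
  obtain ⟨n, b, hb0, rfl⟩ := exists_eq_X_pow_mul hb
  rw [theta_X_pow_mul, theta_X_pow_mul] at h
  have hX (k : ℕ) : (PowerSeries.X : PowerSeries ℂ) ^ k ≠ 0 := pow_ne_zero _ PowerSeries.X_ne_zero
  rcases lt_trichotomy m n with hmn | rfl | hmn
  · obtain ⟨d, rfl⟩ := Nat.exists_eq_add_of_lt hmn
    have h1 : f ^ 2 = PowerSeries.X * (PowerSeries.X ^ d *
        (12 * (b * ((m : PowerSeries ℂ) * f + theta f) -
        f * (((m + d + 1 : ℕ) : PowerSeries ℂ) * b + theta b)))) :=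
      mul_left_cancel₀ (hX (2 * m)) (by linear_combination h)
    have h2 := congrArg PowerSeries.constantCoeff h1
    simp [hf0] at h2
  · have h1 : f ^ 2 = 12 * (b * theta f - f * theta b) :=
      mul_left_cancel₀ (hX (2 * m)) (by linear_combination h)
    have h2 := congrArg PowerSeries.constantCoeff h1
    simp [hf0, constantCoeff_theta] at h2
  · obtain ⟨d, rfl⟩ := Nat.exists_eq_add_of_lt hmn
    have h1 : PowerSeries.X * (PowerSeries.X ^ d * f ^ 2) =
        12 * (((d : PowerSeries ℂ) + 1) * (f * b) + (b * theta f - f * theta b)) :=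
      mul_left_cancel₀ (hX (2 * n + d + 1)) (by push_cast at h; linear_combination h)
    have h2 := congrArg PowerSeries.constantCoeff h1
    have hd : (d : ℂ) + 1 ≠ 0 := by exact_mod_cast d.succ_ne_zero
    simp [hf0, hb0, constantCoeff_theta, hd] at h2
    exact OfNat.ofNat_ne_zero (R := ℂ) 12 ((constantCoeff_ofNat 12).symm.trans h2)

/-- The combination `f ^ 2 + 12 (f θb - b θf)` is genuinely modular of weight `2w`, because it
equals `a² + e4 b²` plus a Rankin–Cohen bracket of `a` and `b`. It vanishes at least to the order of
`f`, and the Sturm bound in weight `2w` is `w / 6`, so it is zero. -/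
theorem eq_zero (hs : IsQuasimodular w s) (h : ∀ i ≤ w.toNat / 6, s.coeff i = 0) : s = 0 := by
  obtain ⟨a, b, ha, hb, rfl⟩ := hs
  set f := a + e2 * b with hf
  have hW : f ^ 2 + 12 * (f * theta b - b * theta f) = a * a + e4 * (b * b) +
      (a * Quasimodular.serreTheta (w - 2) b - b * Quasimodular.serreTheta w a) := by
    simp only [hf, Quasimodular.serreTheta, map_add, theta_mul]
    push_cast
    linear_combination -b ^ 2 * theta_e2
  have hmod : IsModular (2 * w) (f ^ 2 + 12 * (f * theta b - b * theta f)) := by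
    rw [hW]
    exact (((ha.mul ha).cast (by ring)).add ((isModular_e4.mul (hb.mul hb)).cast (by ring))).add
      (((ha.mul hb.serreTheta).cast (by ring)).sub ((hb.mul ha.serreTheta).cast (by ring)))
  have hdvd : (PowerSeries.X : PowerSeries ℂ) ^ (w.toNat / 6 + 1) ∣ f :=
    PowerSeries.X_pow_dvd_iff.mpr fun i hi ↦ h i (Nat.lt_succ_iff.mp hi)
  have hdvd' : (PowerSeries.X : PowerSeries ℂ) ^ (w.toNat / 6 + 1) ∣ theta f := by
    obtain ⟨g, hg⟩ := hdvd
    rw [hg, theta_X_pow_mul]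
    exact dvd_mul_right _ _
  have hzero := hmod.eq_zero fun i hi ↦ by
    refine PowerSeries.X_pow_dvd_iff.mp ?_ i (show i < w.toNat / 6 + 1 by omega)
    exact dvd_add (dvd_pow hdvd two_ne_zero)
      (((hdvd.mul_right _).sub (hdvd'.mul_left _)).mul_left _)
  exact eq_zero_of_sq_eq (b := b) (by linear_combination hzero)

end IsQuasimodular

/-! ### Integrality of the fourth root of `E₄`, of the discriminant and of `1/j`. -/

/-- The ring of power series with integral coefficients. -/
def integralSeries : Subring (PowerSeries ℂ) := (PowerSeries.map (Int.castRingHom ℂ)).range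

theorem coeff_of_mem_integralSeries {s : PowerSeries ℂ} (hs : s ∈ integralSeries) (n : ℕ) :
    ∃ a : ℤ, s.coeff n = a := by
  obtain ⟨t, rfl⟩ := hs
  exact ⟨t.coeff n, by simp⟩

theorem exists_inverse_mem_integralSeries {s : PowerSeries ℂ} (hs : s ∈ integralSeries)
    (h0 : s.constantCoeff = 1) :
    ∃ r ∈ integralSeries, r.constantCoeff = 1 ∧ s * r = 1 := by
  obtain ⟨t, rfl⟩ := hs
  have ht : t.constantCoeff = ((1 : ℤˣ) : ℤ) := by
    have h : ((t.constantCoeff : ℤ) : ℂ) = 1 := by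
      rwa [← PowerSeries.coeff_zero_eq_constantCoeff_apply, PowerSeries.coeff_map,
        PowerSeries.coeff_zero_eq_constantCoeff_apply] at h0
    exact_mod_cast h
  refine ⟨PowerSeries.map (Int.castRingHom ℂ) (t.invOfUnit 1), ⟨_, rfl⟩, ?_, ?_⟩
  · rw [← PowerSeries.coeff_zero_eq_constantCoeff_apply, PowerSeries.coeff_map]
    simp
  rw [← map_mul, PowerSeries.mul_invOfUnit _ _ ht, map_one]

/-- The solution is `z = x C(-c x)`, where `C = 1 + X C²` is the Catalan generating function. -/
theorem exists_add_mul_sq_eq (c : ℤ) {x : PowerSeries ℤ} (hx : x.constantCoeff = 0) :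
    ∃ z : PowerSeries ℤ, z.constantCoeff = 0 ∧ z + (c : PowerSeries ℤ) * z ^ 2 = x := by
  have hs : PowerSeries.HasSubst (-(c : PowerSeries ℤ) * x) :=
    PowerSeries.HasSubst.of_constantCoeff_zero' (by simp [hx])
  have h := congrArg (fun s ↦ PowerSeries.substAlgHom hs (PowerSeries.map (Nat.castRingHom ℤ) s))
    PowerSeries.catalanSeries_sq_mul_X_add_one
  simp only [map_add, map_mul, map_pow, map_one, PowerSeries.map_X,
    PowerSeries.substAlgHom_X] at h
  set y := PowerSeries.substAlgHom hs
    (PowerSeries.map (Nat.castRingHom ℤ) PowerSeries.catalanSeries)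
  exact ⟨x * y, by simp [hx], by linear_combination -x * h⟩

open PowerSeries in
/-- The power series `∑ σ_k(n) q ^ n`. -/
def sigmaSeries (k : ℕ) : ℤ⟦X⟧ := PowerSeries.mk fun n ↦ (ArithmeticFunction.sigma k n : ℤ)

theorem constantCoeff_sigmaSeries (k : ℕ) : (sigmaSeries k).constantCoeff = 0 := by
  simp [sigmaSeries, ← PowerSeries.coeff_zero_eq_constantCoeff_apply]

theorem e4_eq_map : e4 = PowerSeries.map (Int.castRingHom ℂ) (1 + 240 * sigmaSeries 3) := by
  ext n
  rw [coeff_e4]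
  have h : (240 * sigmaSeries 3).coeff n = 240 * ArithmeticFunction.sigma 3 n := by
    rw [show (240 : PowerSeries ℤ) = PowerSeries.C 240 from rfl, PowerSeries.coeff_C_mul]
    simp [sigmaSeries]
  rw [PowerSeries.coeff_map, map_add, h, PowerSeries.coeff_one]
  split_ifs with hn <;> simp [hn]

theorem e6_eq_map : e6 = PowerSeries.map (Int.castRingHom ℂ) (1 - 504 * sigmaSeries 5) := by
  ext n
  rw [coeff_e6]
  have h : (504 * sigmaSeries 5).coeff n = 504 * ArithmeticFunction.sigma 5 n := by
    rw [show (504 : PowerSeries ℤ) = PowerSeries.C 504 from rfl, PowerSeries.coeff_C_mul]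
    simp [sigmaSeries]
  rw [PowerSeries.coeff_map, map_sub, h, PowerSeries.coeff_one]
  split_ifs with hn <;> simp [hn]

theorem e4_mem_integralSeries : e4 ∈ integralSeries := e4_eq_map ▸ ⟨_, rfl⟩

theorem e6_mem_integralSeries : e6 ∈ integralSeries := e6_eq_map ▸ ⟨_, rfl⟩

/-- Two square roots in succession: `(1 + 8z)² = 1 + 16 (z + 4z²)` with `240 = 16 · 15`, and `(1 +
4y)² = 1 + 8 (y + 2y²)`. -/
theorem exists_fourth_root_e4 : ∃ p ∈ integralSeries, p.constantCoeff = 1 ∧ p ^ 4 = e4 := by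
  obtain ⟨z, hz0, hz⟩ := exists_add_mul_sq_eq 4 (x := 15 * sigmaSeries 3)
    (by simp [constantCoeff_sigmaSeries])
  obtain ⟨y, hy0, hy⟩ := exists_add_mul_sq_eq 2 hz0
  push_cast at hy hz
  refine ⟨PowerSeries.map (Int.castRingHom ℂ) (1 + 4 * y), ⟨_, rfl⟩, ?_, ?_⟩
  · rw [← PowerSeries.coeff_zero_eq_constantCoeff_apply, PowerSeries.coeff_map]
    simp [hy0]
  · rw [e4_eq_map, ← map_pow]
    congr 1
    have h : (1 + 4 * y) ^ 2 = 1 + 8 * z := by linear_combination 8 * hy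
    linear_combination ((1 + 4 * y) ^ 2 + (1 + 8 * z)) * h + 16 * hz

/-- The linear part of `e4 ^ 3 - e6 ^ 2` is `144 (5 σ₃ + 7 σ₅)`, so integrality of the discriminant
rests on this divisibility. It holds divisor by divisor: `12 ∣ 5d³ + 7d⁵`. -/
theorem twelve_dvd_sigma (n : ℕ) :
    (12 : ℤ) ∣ 5 * ArithmeticFunction.sigma 3 n + 7 * ArithmeticFunction.sigma 5 n := by
  simp only [ArithmeticFunction.sigma_apply]
  push_cast
  rw [Finset.mul_sum, Finset.mul_sum, ← Finset.sum_add_distrib]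
  refine Finset.dvd_sum fun d _ ↦ ?_
  refine (ZMod.intCast_zmod_eq_zero_iff_dvd _ 12).mp ?_
  push_cast
  generalize (d : ZMod 12) = x
  revert x
  decide

/-- The power series of the discriminant form. -/
theorem exists_discriminant_series :
    ∃ δ ∈ integralSeries, δ.coeff 0 = 0 ∧ δ.coeff 1 = 1 ∧ 1728 * δ = e4 ^ 3 - e6 ^ 2 := by
  set a := sigmaSeries 3 with ha
  set b := sigmaSeries 5 with hb
  obtain ⟨c, hc⟩ : ∃ c : PowerSeries ℤ, 5 * a + 7 * b = 12 * c := by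
    choose f hf using twelve_dvd_sigma
    refine ⟨PowerSeries.mk f, ?_⟩
    ext n
    rw [show (5 : PowerSeries ℤ) = PowerSeries.C 5 from rfl,
      show (7 : PowerSeries ℤ) = PowerSeries.C 7 from rfl,
      show (12 : PowerSeries ℤ) = PowerSeries.C 12 from rfl, map_add, PowerSeries.coeff_C_mul,
      PowerSeries.coeff_C_mul, PowerSeries.coeff_C_mul]
    simpa [ha, hb, sigmaSeries] using hf n
  set δ := PowerSeries.map (Int.castRingHom ℂ) (c + 100 * a ^ 2 + 8000 * a ^ 3 - 147 * b ^ 2)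
  have h : 1728 * δ = e4 ^ 3 - e6 ^ 2 := by
    rw [e4_eq_map, e6_eq_map, ← map_pow, ← map_pow, ← map_sub,
      ← map_ofNat (PowerSeries.map (Int.castRingHom ℂ)) 1728, ← map_mul]
    congr 1
    linear_combination -144 * hc
  have h' (n : ℕ) : 1728 * δ.coeff n = (e4 ^ 3 - e6 ^ 2).coeff n := by
    rw [← h, show (1728 : PowerSeries ℂ) = PowerSeries.C 1728 from rfl, PowerSeries.coeff_C_mul]
  have h1728 : (1728 : ℂ) ≠ 0 := by norm_num
  refine ⟨δ, ⟨_, rfl⟩, mul_left_cancel₀ h1728 ?_, mul_left_cancel₀ h1728 ?_, h⟩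
  · rw [h']
    simp [constantCoeff_e4, constantCoeff_e6]
  · rw [h']
    norm_num [pow_succ, PowerSeries.coeff_mul, Finset.Nat.antidiagonal_succ, coeff_e4, coeff_e6]

/-- The data entering the hypergeometric expansion: `p` is the fourth root of `E₄`, `r` its inverse
and `u` is the reciprocal of the modular invariant. -/
structure IsHypergeometricFrame (p r u : PowerSeries ℂ) : Prop where
  mem_p : p ∈ integralSeries
  mem_r : r ∈ integralSeries
  mem_u : u ∈ integralSeries
  constantCoeff_p : p.constantCoeff = 1
  constantCoeff_r : r.constantCoeff = 1
  coeff_zero_u : u.coeff 0 = 0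
  coeff_one_u : u.coeff 1 = 1
  mul_eq_one : p * r = 1
  pow_eq : p ^ 4 = e4
  theta_r : 12 * theta r = e6 * r ^ 5 - e2 * r
  theta_u : theta u = u * e6 * r ^ 4
  e6_sq : e6 ^ 2 * r ^ 12 = 1 - 1728 * u

/-- Here `u = Δ / E₄³`. Ramanujan's identities give `θΔ = E₂ Δ`, and the `E₂` terms cancel in the
logarithmic derivative of `u`, leaving `E₆ / E₄`. -/
theorem exists_isHypergeometricFrame : ∃ p r u, IsHypergeometricFrame p r u := by
  obtain ⟨p, hp, hp0, hp4⟩ := exists_fourth_root_e4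
  obtain ⟨r, hr, hr0, hpr⟩ := exists_inverse_mem_integralSeries hp hp0
  obtain ⟨δ, hδ, hδ0, hδ1, hδe⟩ := exists_discriminant_series
  have hr4 : e4 * r ^ 4 = 1 := by rw [← hp4, ← mul_pow, hpr, one_pow]
  have h1 := congrArg theta hr4
  have h2 := congrArg theta hδe
  have h1728 : theta 1728 = 0 := theta.map_natCast 1728
  simp only [theta_mul, theta_pow, map_sub, h1728, Derivation.map_one_eq_zero] at h1 h2
  push_cast at h1 h2
  norm_num at h1 h2
  have hθr : 12 * theta r = e6 * r ^ 5 - e2 * r := by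
    linear_combination 3 * r * h1 - (12 * theta r) * hr4 - r ^ 5 * theta_e4 - e2 * r * hr4
  have hθδ : theta δ = e2 * δ := by
    refine mul_left_cancel₀ (ofNat_ne_zero 1728) ?_
    linear_combination h2 + e4 ^ 2 * theta_e4 - e6 * theta_e6 - e2 * hδe
  refine ⟨p, r, δ * r ^ 12, hp, hr, mul_mem hδ (pow_mem hr _), hp0, hr0, ?_, ?_, hpr, hp4, hθr,
    ?_, ?_⟩
  · rw [PowerSeries.coeff_zero_eq_constantCoeff_apply] at hδ0
    simp [hδ0]
  · have := PowerSeries.coeff_mul 1 δ (r ^ 12)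
    rw [PowerSeries.coeff_mul]
    simp [Finset.Nat.antidiagonal_succ, hδ0, hδ1, hr0]
  · rw [theta_mul, theta_pow, hθδ]
    push_cast
    linear_combination δ * r ^ 11 * hθr
  · have : r ^ 12 * e4 ^ 3 = 1 := by linear_combination (e4 ^ 2 * r ^ 8 + e4 * r ^ 4 + 1) * hr4
    linear_combination r ^ 12 * hδe + this

/-! ### The Kaneko–Zagier operator. -/

theorem theta_intCast (c : ℤ) : theta (c : PowerSeries ℂ) = 0 := theta.map_intCast c

theorem serreTheta_sub (k : ℤ) (s t : PowerSeries ℂ) :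
    serreTheta k (s - t) = serreTheta k s - serreTheta k t := by
  simp only [serreTheta, map_sub]
  ring

theorem serreTheta_add (k : ℤ) (s t : PowerSeries ℂ) :
    serreTheta k (s + t) = serreTheta k s + serreTheta k t := by
  simp only [serreTheta, map_add]
  ring

theorem serreTheta_intCast_mul (k c : ℤ) (s : PowerSeries ℂ) :
    serreTheta k (c * s) = c * serreTheta k s := by
  simp only [serreTheta, theta_mul, theta_intCast]
  ring

theorem X_pow_dvd_serreTheta {m : ℕ} {s : PowerSeries ℂ} (k : ℤ) (h : PowerSeries.X ^ m ∣ s) :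
    PowerSeries.X ^ m ∣ serreTheta k s := by
  obtain ⟨g, rfl⟩ := h
  rw [serreTheta, theta_X_pow_mul]
  exact ⟨12 * ((m : PowerSeries ℂ) * g + theta g) - k * e2 * g, by ring⟩

theorem coeff_mul_of_X_pow_dvd {m : ℕ} {s : PowerSeries ℂ} (t : PowerSeries ℂ)
    (h : PowerSeries.X ^ m ∣ s) : (t * s).coeff m = t.constantCoeff * s.coeff m := by
  obtain ⟨g, rfl⟩ := h
  rw [show t * (PowerSeries.X ^ m * g) = PowerSeries.X ^ m * (t * g) by ring,
    PowerSeries.coeff_X_pow_mul', PowerSeries.coeff_X_pow_mul']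
  simp

theorem coeff_serreTheta {m : ℕ} {s : PowerSeries ℂ} (k : ℤ) (h : PowerSeries.X ^ m ∣ s) :
    (serreTheta k s).coeff m = (12 * m - k) * s.coeff m := by
  have h1 : (12 * theta s).coeff m = 12 * (m * s.coeff m) := by
    rw [← coeff_theta, show (12 : PowerSeries ℂ) = PowerSeries.C 12 from rfl,
      PowerSeries.coeff_C_mul]
  rw [serreTheta, map_sub, h1, coeff_mul_of_X_pow_dvd _ h, map_mul, constantCoeff_e2, map_intCast]
  ring

/-- The second order differential operator on forms of weight `6n` that annihilates the extremal
quasimodular form of depth one. -/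
def kanekoZagier (n : ℕ) (s : PowerSeries ℂ) : PowerSeries ℂ :=
  serreTheta (6 * n + 1) (serreTheta (6 * n - 1) s) -
    ((36 * n ^ 2 - 1 : ℤ) : PowerSeries ℂ) * e4 * s

theorem kanekoZagier_sub (n : ℕ) (s t : PowerSeries ℂ) :
    kanekoZagier n (s - t) = kanekoZagier n s - kanekoZagier n t := by
  simp only [kanekoZagier, serreTheta_sub]
  ring

theorem kanekoZagier_add (n : ℕ) (s t : PowerSeries ℂ) :
    kanekoZagier n (s + t) = kanekoZagier n s + kanekoZagier n t := by
  simp only [kanekoZagier, serreTheta_add]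
  ring

theorem kanekoZagier_intCast_mul (n : ℕ) (c : ℤ) (s : PowerSeries ℂ) :
    kanekoZagier n (c * s) = c * kanekoZagier n s := by
  simp only [kanekoZagier, serreTheta_intCast_mul]
  ring

theorem X_pow_dvd_kanekoZagier {m n : ℕ} {s : PowerSeries ℂ} (h : PowerSeries.X ^ m ∣ s) :
    PowerSeries.X ^ m ∣ kanekoZagier n s :=
  (X_pow_dvd_serreTheta _ (X_pow_dvd_serreTheta _ h)).sub (h.mul_left _)

/-- The indicial polynomial is `(12m - 6n - 1)(12m - 6n + 1) - (36n² - 1)`. The constant `36n² - 1`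
in the operator is what makes its roots `0` and `n`. -/
theorem coeff_kanekoZagier {m n : ℕ} {s : PowerSeries ℂ} (h : PowerSeries.X ^ m ∣ s) :
    (kanekoZagier n s).coeff m = 144 * m * (m - n) * s.coeff m := by
  rw [kanekoZagier, map_sub, coeff_serreTheta _ (X_pow_dvd_serreTheta _ h), coeff_serreTheta _ h,
    coeff_mul_of_X_pow_dvd _ h, map_mul, constantCoeff_e4, map_intCast]
  push_cast
  ring

/-- The image has weight `6n + 4` and depth at most one, so it must be checked only through order
`n`. The coefficient at `n` dies because `n` is an exponent. -/
theorem IsQuasimodular.kanekoZagier_eq_zero {n : ℕ} {s : PowerSeries ℂ}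
    (hs : IsQuasimodular (6 * n) s) (h : PowerSeries.X ^ n ∣ s) : kanekoZagier n s = 0 := by
  have h1 : IsQuasimodular (6 * n + 4) (kanekoZagier n s) := by
    have h2 := hs.serreTheta.serreTheta
    rw [show (6 * n + 2 - 1 : ℤ) = 6 * n + 1 by ring] at h2
    have h3 := (IsQuasimodular.modular_mul isModular_e4 hs).intCast_mul (36 * n ^ 2 - 1)
    rw [← mul_assoc] at h3
    exact (h2.cast (by ring)).sub (h3.cast (by ring))
  refine h1.eq_zero fun i hi ↦ ?_
  have hi' : i ≤ n := by omega
  rcases hi'.lt_or_eq with hlt | rfl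
  · exact PowerSeries.X_pow_dvd_iff.mp (X_pow_dvd_kanekoZagier h) i hlt
  · rw [coeff_kanekoZagier h]
    ring

/-- No exponent exceeds `n`, so beyond order `n` the operator preserves leading terms up to a
nonzero factor. -/
theorem X_pow_dvd_of_kanekoZagier {n N : ℕ} {s : PowerSeries ℂ}
    (hL : PowerSeries.X ^ N ∣ kanekoZagier n s) (h : PowerSeries.X ^ (n + 1) ∣ s) :
    PowerSeries.X ^ N ∣ s := by
  have (k : ℕ) (hk : k ≤ N) : PowerSeries.X ^ k ∣ s := by
    induction k with
    | zero => simp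
    | succ k ih =>
      rcases le_or_gt k n with hkn | hkn
      · exact (pow_dvd_pow _ (by omega)).trans h
      · have hd := ih (by omega)
        have h0 := PowerSeries.X_pow_dvd_iff.mp hL k (by omega)
        rw [coeff_kanekoZagier hd] at h0
        have h1 : (k : ℂ) ≠ 0 := by exact_mod_cast (show k ≠ 0 by omega)
        have h2 : (k : ℂ) - n ≠ 0 := sub_ne_zero.mpr (by exact_mod_cast hkn.ne')
        refine PowerSeries.X_pow_dvd_iff.mpr fun i hi ↦ ?_
        rcases (Nat.lt_succ_iff.mp hi).lt_or_eq with hi | rfl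
        · exact PowerSeries.X_pow_dvd_iff.mp hd i hi
        · simpa [h1, h2] using h0
  exact this N le_rfl

/-! ### The hypergeometric expansion in powers of `1/j`. -/

namespace IsHypergeometricFrame

variable {p r u : PowerSeries ℂ}

theorem theta_p_pow (h : IsHypergeometricFrame p r u) (k : ℕ) :
    12 * theta (p ^ k) = k * p ^ k * (e2 - e6 * r ^ 4) := by
  have h1 := congrArg theta h.mul_eq_one
  rw [theta_mul, Derivation.map_one_eq_zero] at h1
  have hp : 12 * theta p = p * (e2 - e6 * r ^ 4) := by
    linear_combination 12 * p * h1 - 12 * theta p * h.mul_eq_one - p ^ 2 * h.theta_r +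
      (e2 * p - e6 * r ^ 4 * p) * h.mul_eq_one
  induction k with
  | zero => simp
  | succ k ih =>
    rw [pow_succ, theta_mul]
    push_cast
    linear_combination p * ih + p ^ k * hp

theorem theta_u_pow (h : IsHypergeometricFrame p r u) (k : ℕ) :
    theta (u ^ k) = k * u ^ k * (e6 * r ^ 4) := by
  induction k with
  | zero => simp
  | succ k ih =>
    rw [pow_succ, theta_mul]
    push_cast
    linear_combination u * ih + u ^ k * h.theta_u

/-- The factor `r * p ^ (6 * n)` is `E₄ ^ ((6n - 1) / 4)`, of weight `6n - 1`, and `u` has weight 0.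
The Serre derivative of that weight therefore contains no `e2`. -/
theorem serreTheta_term (h : IsHypergeometricFrame p r u) (n s : ℕ) :
    serreTheta (6 * n - 1) (r * p ^ (6 * n) * u ^ s) =
      ((12 * s - 6 * n + 1 : ℤ) : PowerSeries ℂ) * (r * p ^ (6 * n) * u ^ s * (e6 * r ^ 4)) := by
  have h1 := h.theta_p_pow (6 * n)
  have h2 := h.theta_u_pow s
  push_cast at h1
  simp only [serreTheta, theta_mul]
  push_cast
  linear_combination 12 * r * p ^ (6 * n) * h2 + r * u ^ s * h1 + p ^ (6 * n) * u ^ s * h.theta_r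

/-- Applying `serreTheta` twice produces `E₆² / E₄²`, which is `E₄ (1 - 1728 u)`. Only the powers
`s` and `s + 1` of `u` survive, hence a two-term recursion. -/
theorem kanekoZagier_term (h : IsHypergeometricFrame p r u) (n s : ℕ) :
    kanekoZagier n (r * p ^ (6 * n) * u ^ s) =
      e4 * ((144 * s * (s - n) : ℤ) * (r * p ^ (6 * n) * u ^ s) -
        ((1728 * (12 * s - 6 * n + 1) * (12 * s - 6 * n + 5) : ℤ) : PowerSeries ℂ) *
          (r * p ^ (6 * n) * u ^ (s + 1))) := by
  rw [kanekoZagier, h.serreTheta_term, serreTheta_intCast_mul]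
  set T := r * p ^ (6 * n) * u ^ s with hT
  have h1 := h.serreTheta_term n s
  rw [← hT, serreTheta] at h1
  have hr := h.theta_r
  have hr4 : e4 * r ^ 4 = 1 := by
    rw [← h.pow_eq, ← mul_pow, h.mul_eq_one, one_pow]
  have hE : 6 * theta (e6 * r ^ 4) = e2 * e6 * r ^ 4 - 3 * e4 + 2 * e6 ^ 2 * r ^ 8 := by
    rw [theta_mul, theta_pow]
    push_cast
    linear_combination 3 * r ^ 4 * theta_e6 + 2 * e6 * r ^ 3 * hr - 3 * e4 * hr4
  have h8 : e6 ^ 2 * r ^ 8 = e4 * (1 - 1728 * u) := by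
    linear_combination e4 * h.e6_sq - e6 ^ 2 * r ^ 8 * hr4
  rw [show r * p ^ (6 * n) * u ^ (s + 1) = T * u by rw [hT]; ring]
  rw [serreTheta, theta_mul]
  push_cast at h1 ⊢
  linear_combination (12 * (s : PowerSeries ℂ) - 6 * n + 1) * (e6 * r ^ 4 * h1 + 2 * T * hE) +
    (12 * (s : PowerSeries ℂ) - 6 * n + 1) * (12 * s - 6 * n + 5) * T * h8

/-- Partial sums of the hypergeometric expansion. -/
theorem kanekoZagier_sum (h : IsHypergeometricFrame p r u) (n : ℕ) {b : ℕ → ℤ}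
    (hb : ∀ i : ℕ, b (i + 1) * ((n + i + 1) * (i + 1)) =
      12 * (12 * i + 6 * n + 1) * (12 * i + 6 * n + 5) * b i) (N : ℕ) :
    kanekoZagier n (∑ i ∈ Finset.range (N + 1),
      (b i : PowerSeries ℂ) * (r * p ^ (6 * n) * u ^ (n + i))) =
    -e4 * ((1728 * (12 * N + 6 * n + 1) * (12 * N + 6 * n + 5) * b N : ℤ) : PowerSeries ℂ) *
      (r * p ^ (6 * n) * u ^ (n + N + 1)) := by
  induction N with
  | zero =>
    rw [Finset.sum_range_one, kanekoZagier_intCast_mul, h.kanekoZagier_term]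
    push_cast
    ring
  | succ N ih =>
    have hbN := congrArg (Int.cast : ℤ → PowerSeries ℂ) (hb N)
    rw [Finset.sum_range_succ, kanekoZagier_add, ih, kanekoZagier_intCast_mul,
      h.kanekoZagier_term]
    push_cast at hbN ⊢
    linear_combination 144 * e4 * (r * p ^ (6 * n) * u ^ (n + N + 1)) * hbN

theorem X_dvd_u (h : IsHypergeometricFrame p r u) : PowerSeries.X ∣ u :=
  PowerSeries.X_dvd_iff.mpr (by simpa using h.coeff_zero_u)

theorem X_pow_dvd_term (h : IsHypergeometricFrame p r u) (n s : ℕ) :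
    PowerSeries.X ^ s ∣ r * p ^ (6 * n) * u ^ s :=
  (pow_dvd_pow_of_dvd h.X_dvd_u s).mul_left _

theorem coeff_term (h : IsHypergeometricFrame p r u) (n s : ℕ) :
    (r * p ^ (6 * n) * u ^ s).coeff s = 1 := by
  obtain ⟨v, hv⟩ := h.X_dvd_u
  have hv1 : v.constantCoeff = 1 := by
    have := h.coeff_one_u
    rw [hv, show 1 = 0 + 1 from rfl, PowerSeries.coeff_succ_X_mul] at this
    simpa using this
  rw [hv, mul_pow, show r * p ^ (6 * n) * (PowerSeries.X ^ s * v ^ s) =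
    PowerSeries.X ^ s * (r * p ^ (6 * n) * v ^ s) by ring, PowerSeries.coeff_X_pow_mul']
  simp [hv1, h.constantCoeff_p, h.constantCoeff_r]

/-- The operator kills `s` and sends the partial sum to a single term of order `n + N + 1`. The
leading terms at `q ^ n` agree, so the difference starts beyond the last exponent and
`X_pow_dvd_of_kanekoZagier` applies. -/
theorem X_pow_dvd_sub_sum (h : IsHypergeometricFrame p r u) {n : ℕ} {b : ℕ → ℤ}
    (hb : ∀ i : ℕ, b (i + 1) * ((n + i + 1) * (i + 1)) =
      12 * (12 * i + 6 * n + 1) * (12 * i + 6 * n + 5) * b i) {s : PowerSeries ℂ}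
    (hs : IsQuasimodular (6 * n) s) (hdvd : PowerSeries.X ^ n ∣ s) (hcoeff : s.coeff n = b 0)
    (N : ℕ) :
    PowerSeries.X ^ (n + N + 1) ∣ s - ∑ i ∈ Finset.range (N + 1),
      (b i : PowerSeries ℂ) * (r * p ^ (6 * n) * u ^ (n + i)) := by
  refine X_pow_dvd_of_kanekoZagier (n := n) ?_ ?_
  · rw [kanekoZagier_sub, hs.kanekoZagier_eq_zero hdvd, h.kanekoZagier_sum n hb, zero_sub]
    exact (((h.X_pow_dvd_term n (n + N + 1))).mul_left _).neg_right
  · rw [Finset.sum_range_succ', ← sub_sub, sub_right_comm]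
    simp only [add_zero]
    refine dvd_sub (PowerSeries.X_pow_dvd_iff.mpr fun i hi ↦ ?_) (Finset.dvd_sum fun i _ ↦ ?_)
    · have h0 := h.X_pow_dvd_term n n
      rcases (Nat.lt_succ_iff.mp hi).lt_or_eq with hi | rfl
      · exact PowerSeries.X_pow_dvd_iff.mp (hdvd.sub (h0.mul_left _)) i hi
      · rw [map_sub, hcoeff, coeff_mul_of_X_pow_dvd _ h0, h.coeff_term]
        simp
    · exact ((pow_dvd_pow _ (by omega)).trans (h.X_pow_dvd_term n (n + (i + 1)))).mul_left _

theorem term_mem (h : IsHypergeometricFrame p r u) (n s : ℕ) :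
    r * p ^ (6 * n) * u ^ s ∈ integralSeries :=
  mul_mem (mul_mem h.mem_r (pow_mem h.mem_p _)) (pow_mem h.mem_u _)

end IsHypergeometricFrame

/-- Each coefficient is read off from a finite partial sum, so no infinite sum has to be formed. -/
theorem mem_integralSeries_of_forall {s : PowerSeries ℂ}
    (h : ∀ N : ℕ, ∃ t ∈ integralSeries, PowerSeries.X ^ (N + 1) ∣ s - t) (n : ℕ) :
    ∃ a : ℤ, s.coeff n = a := by
  obtain ⟨t, ht, hd⟩ := h n
  have := PowerSeries.X_pow_dvd_iff.mp hd n (Nat.lt_succ_self n)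
  rw [map_sub, sub_eq_zero] at this
  rw [this]
  exact coeff_of_mem_integralSeries ht n

theorem exists_coeff_eq_intCast {n : ℕ} {b : ℕ → ℤ}
    (hb : ∀ i : ℕ, b (i + 1) * ((n + i + 1) * (i + 1)) =
      12 * (12 * i + 6 * n + 1) * (12 * i + 6 * n + 5) * b i) {s : PowerSeries ℂ}
    (hs : IsQuasimodular (6 * n) s) (hdvd : PowerSeries.X ^ n ∣ s) (hcoeff : s.coeff n = b 0)
    (k : ℕ) : ∃ a : ℤ, s.coeff k = a := by
  obtain ⟨p, r, u, h⟩ := exists_isHypergeometricFrame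
  refine mem_integralSeries_of_forall (fun N ↦ ⟨_, sum_mem fun i _ ↦
    mul_mem (intCast_mem _ (b i)) (h.term_mem n (n + i)), (pow_dvd_pow _ ?_).trans
      (h.X_pow_dvd_sub_sum hb hs hdvd hcoeff N)⟩) k
  omega

theorem exists_coeff_eq_intCast_of_serreTheta {n : ℕ} {b c : ℕ → ℤ}
    (hb : ∀ i : ℕ, b (i + 1) * ((n + i + 1) * (i + 1)) =
      12 * (12 * i + 6 * n + 1) * (12 * i + 6 * n + 5) * b i)
    (hc : ∀ i : ℕ, (6 * n - 1) * c i = (12 * i + 6 * n + 1) * b i) {s t : PowerSeries ℂ}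
    (hs : IsQuasimodular (6 * n) s) (hdvd : PowerSeries.X ^ n ∣ s) (hcoeff : s.coeff n = b 0)
    (ht : ((6 * n - 1 : ℤ) : PowerSeries ℂ) * t = serreTheta (6 * n - 1) s)
    (k : ℕ) : ∃ a : ℤ, t.coeff k = a := by
  obtain ⟨p, r, u, h⟩ := exists_isHypergeometricFrame
  refine mem_integralSeries_of_forall (fun N ↦ ⟨∑ i ∈ Finset.range (N + 1),
    (c i : PowerSeries ℂ) * (r * p ^ (6 * n) * u ^ (n + i) * (e6 * r ^ 4)), sum_mem fun i _ ↦
    mul_mem (intCast_mem _ (c i)) (mul_mem (h.term_mem n (n + i))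
      (mul_mem e6_mem_integralSeries (pow_mem h.mem_r 4))), ?_⟩) k
  have h1 := X_pow_dvd_serreTheta (6 * n - 1) (h.X_pow_dvd_sub_sum hb hs hdvd hcoeff N)
  have h2 : serreTheta (6 * n - 1) (∑ i ∈ Finset.range (N + 1),
      (b i : PowerSeries ℂ) * (r * p ^ (6 * n) * u ^ (n + i))) =
      ((6 * n - 1 : ℤ) : PowerSeries ℂ) * ∑ i ∈ Finset.range (N + 1),
        (c i : PowerSeries ℂ) * (r * p ^ (6 * n) * u ^ (n + i) * (e6 * r ^ 4)) := by
    have hsum (w : ℤ) (f : ℕ → PowerSeries ℂ) (S : Finset ℕ) :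
        serreTheta w (∑ i ∈ S, f i) = ∑ i ∈ S, serreTheta w (f i) := by
      simp only [serreTheta, map_sum, Finset.mul_sum, Finset.sum_sub_distrib]
    rw [hsum, Finset.mul_sum]
    refine Finset.sum_congr rfl fun i _ ↦ ?_
    have hci := congrArg (Int.cast : ℤ → PowerSeries ℂ) (hc i)
    rw [serreTheta_intCast_mul, h.serreTheta_term]
    push_cast at hci ⊢
    linear_combination -(r * p ^ (6 * n) * u ^ (n + i) * (e6 * r ^ 4)) * hci
  rw [serreTheta_sub, h2, ← ht, ← mul_sub] at h1
  -- The factor `6n - 1` is nonzero for every `n`, including `n = 0`, hence invertible over `ℂ` and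
  -- harmless for orders of vanishing.
  have hunit : IsUnit ((6 * n - 1 : ℤ) : PowerSeries ℂ) := by
    rw [PowerSeries.isUnit_iff_constantCoeff, map_intCast, isUnit_iff_ne_zero]
    exact_mod_cast (show (6 * n - 1 : ℤ) ≠ 0 by omega)
  exact (pow_dvd_pow _ (by omega)).trans ((hunit.dvd_mul_left).mp h1)

/-! ### Integrality of the hypergeometric coefficients. -/

/-- The product of the first `M` terms of the arithmetic progression `x, x + 12, x + 24, …`. -/
def progressionProd (x : ℤ) (M : ℕ) : ℤ := ∏ k ∈ Finset.range M, (12 * (k : ℤ) + x)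

theorem progressionProd_succ (x : ℤ) (M : ℕ) :
    progressionProd x (M + 1) = progressionProd x M * (12 * M + x) :=
  Finset.prod_range_succ _ _

theorem progressionProd_add_twelve_mul (x : ℤ) (M : ℕ) :
    progressionProd (x + 12) M * x = progressionProd x (M + 1) := by
  rw [progressionProd, progressionProd, Finset.prod_range_succ']
  push_cast
  rw [zero_add]
  congr 1
  exact Finset.prod_congr rfl fun k _ ↦ by ring

/-- Modulo `r` the number 12 is invertible, so `x ≡ 12 z` and the product becomes `12 ^ M z (z + 1)
⋯ (z + M - 1)`, a multiple of `M!`. -/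
theorem dvd_progressionProd {r M : ℕ} (hr : r ∣ M.factorial) (hcop : Nat.Coprime 12 r) (x : ℤ) :
    (r : ℤ) ∣ progressionProd x M := by
  have hr0 : (r : ℤ) ≠ 0 := by
    rintro h
    rw [Int.natCast_eq_zero.mp h, zero_dvd_iff] at hr
    exact M.factorial_ne_zero hr
  obtain ⟨v, w, hvw⟩ := (Nat.isCoprime_iff_coprime (m := 12) (n := r)).mpr hcop
  obtain ⟨z, hz⟩ : ∃ z : ℕ, (r : ℤ) ∣ 12 * (z : ℤ) - x := by
    refine ⟨((v * x) % r).toNat, ?_⟩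
    rw [Int.toNat_of_nonneg (Int.emod_nonneg _ hr0), Int.emod_def]
    exact ⟨-(w * x) - 12 * ((v * x) / r), by push_cast at hvw; linear_combination x * hvw⟩
  have h1 : (12 : ℤ) ^ M * (z.ascFactorial M : ℕ) ≡ progressionProd x M [ZMOD r] := by
    rw [Nat.ascFactorial_eq_prod_range, progressionProd, ← Finset.card_range M,
      ← Finset.prod_const, Finset.card_range]
    push_cast
    rw [← Finset.prod_mul_distrib]
    refine Int.ModEq.prod fun k _ ↦ (Int.modEq_iff_dvd.mpr ?_).symm
    exact hz.trans (dvd_of_eq (by ring))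
  have h2 : (r : ℤ) ∣ (12 : ℤ) ^ M * (z.ascFactorial M : ℕ) :=
    (Int.natCast_dvd_natCast.mpr (hr.trans (Nat.factorial_dvd_ascFactorial z M))).mul_left _
  exact (Int.modEq_zero_iff_dvd).mp (h1.symm.trans (Int.modEq_zero_iff_dvd.mpr h2))

/-- Split `M! = 2^a 3^b r` with `r` prime to 6. Each progression absorbs one factor `r`. By
Legendre's formula `a ≤ M` and `2b ≤ M`, so `12 ^ M` absorbs `2^(2a) 3^(2b)`. -/
theorem sq_factorial_dvd (x y : ℤ) (M : ℕ) :
    (M.factorial : ℤ) ^ 2 ∣ 12 ^ M * progressionProd x M * progressionProd y M := by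
  obtain ⟨a, s, hs, hM⟩ := Nat.exists_eq_pow_mul_and_not_dvd M.factorial_ne_zero 2 (by norm_num)
  have hs0 : s ≠ 0 := by
    rintro rfl
    simp at hs
  obtain ⟨b, r, hr, hsr⟩ := Nat.exists_eq_pow_mul_and_not_dvd hs0 3 (by norm_num)
  have h2r : ¬ 2 ∣ r := fun h ↦ hs (hsr ▸ h.mul_left _)
  have ha : a ≤ M := by
    have h := @sub_one_mul_padicValNat_factorial 2 _ M
    have h' := (padicValNat_dvd_iff_le (p := 2) M.factorial_ne_zero).mp ⟨s, hM⟩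
    omega
  have hb : 2 * b ≤ M := by
    have h := @sub_one_mul_padicValNat_factorial 3 _ M
    have h' := (padicValNat_dvd_iff_le (p := 3) (n := b) M.factorial_ne_zero).mp
      ⟨2 ^ a * r, by rw [hM, hsr]; ring⟩
    omega
  have hcop : Nat.Coprime 12 r := by
    have h2 := (Nat.Prime.coprime_iff_not_dvd Nat.prime_two).mpr h2r
    have h3 := (Nat.Prime.coprime_iff_not_dvd Nat.prime_three).mpr hr
    exact Nat.Coprime.mul_left (Nat.Coprime.mul_left h2 h2) h3
  have hrM : r ∣ M.factorial := ⟨2 ^ a * 3 ^ b, by rw [hM, hsr]; ring⟩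
  have h12 : ((4 : ℤ) ^ a * 3 ^ (2 * b)) ∣ 12 ^ M := by
    rw [show (12 : ℤ) = 4 * 3 by norm_num, mul_pow]
    exact mul_dvd_mul (pow_dvd_pow _ ha) (pow_dvd_pow _ hb)
  have h := mul_dvd_mul (mul_dvd_mul h12 (dvd_progressionProd hrM hcop x))
    (dvd_progressionProd hrM hcop y)
  refine (dvd_of_eq ?_).trans h
  rw [hM, hsr]
  push_cast
  rw [show (4 : ℤ) ^ a = (2 ^ a) ^ 2 by rw [← pow_mul, mul_comm, pow_mul]; norm_num]
  ring

/-- The integer `12 ^ M ∏ (12k + x) ∏ (12k + y) / M! ^ 2`. -/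
def progressionQuot (x y : ℤ) (M : ℕ) : ℤ :=
  12 ^ M * progressionProd x M * progressionProd y M / (M.factorial : ℤ) ^ 2

theorem progressionQuot_mul (x y : ℤ) (M : ℕ) :
    progressionQuot x y M * (M.factorial : ℤ) ^ 2 =
      12 ^ M * progressionProd x M * progressionProd y M :=
  Int.ediv_mul_cancel (sq_factorial_dvd x y M)

theorem progressionQuot_succ (x y : ℤ) (M : ℕ) :
    progressionQuot x y (M + 1) * ((M : ℤ) + 1) ^ 2 =
      12 * (12 * M + x) * (12 * M + y) * progressionQuot x y M := by
  have h1 := progressionQuot_mul x y (M + 1)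
  have h0 := progressionQuot_mul x y M
  have hM : (M.factorial : ℤ) ^ 2 ≠ 0 := pow_ne_zero _ (by exact_mod_cast M.factorial_ne_zero)
  refine mul_right_cancel₀ hM ?_
  rw [progressionProd_succ, progressionProd_succ, Nat.factorial_succ] at h1
  push_cast at h1
  linear_combination h1 - 12 * (12 * M + x) * (12 * M + y) * h0

theorem progressionQuot_add_twelve (x y : ℤ) (M : ℕ) :
    x * progressionQuot (x + 12) y M = (12 * M + x) * progressionQuot x y M := by
  have h1 := progressionQuot_mul (x + 12) y M
  have h0 := progressionQuot_mul x y M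
  have h2 := progressionProd_add_twelve_mul x M
  rw [progressionProd_succ] at h2
  have hM : (M.factorial : ℤ) ^ 2 ≠ 0 := pow_ne_zero _ (by exact_mod_cast M.factorial_ne_zero)
  refine mul_right_cancel₀ hM ?_
  linear_combination x * h1 - (12 * M + x) * h0 + 12 ^ M * progressionProd y M * h2

/-- The coefficients of the hypergeometric expansion of the extremal form of weight `6n`. -/
def hypergeometricCoeff (n i : ℕ) : ℤ :=
  (n + i).choose n * progressionQuot (1 - 6 * n) (5 - 6 * n) (n + i)

/-- The coefficients of the hypergeometric expansion of the extremal form of weight `6n + 2`. -/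
def hypergeometricCoeff' (n i : ℕ) : ℤ :=
  -((n + i).choose n * progressionQuot (1 - 6 * n + 12) (5 - 6 * n) (n + i))

theorem hypergeometricCoeff_succ (n i : ℕ) :
    hypergeometricCoeff n (i + 1) * ((n + i + 1) * (i + 1)) =
      12 * (12 * i + 6 * n + 1) * (12 * i + 6 * n + 5) * hypergeometricCoeff n i := by
  have h1 := progressionQuot_succ (1 - 6 * n) (5 - 6 * n) (n + i)
  have h2 := congrArg (Nat.cast : ℕ → ℤ) (Nat.choose_mul_succ_eq (n + i) n)
  rw [show n + i + 1 - n = i + 1 by omega] at h2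
  rw [hypergeometricCoeff, hypergeometricCoeff, ← add_assoc n i 1]
  push_cast at h1 h2 ⊢
  linear_combination ((n + i).choose n : ℤ) * h1 -
    progressionQuot (1 - 6 * n) (5 - 6 * n) (n + i + 1) * (n + i + 1) * h2

/-- Shifting the progression by 12 trades its first factor `1 - 6n` for a new last factor `12i + 6n
+ 1`, so the division by `6n - 1` is built in. The sign in `hypergeometricCoeff'` comes from `1 - 6n
= -(6n - 1)`. -/
theorem hypergeometricCoeff'_mul (n i : ℕ) :
    (6 * n - 1) * hypergeometricCoeff' n i = (12 * i + 6 * n + 1) * hypergeometricCoeff n i := by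
  have h := progressionQuot_add_twelve (1 - 6 * n) (5 - 6 * n) (n + i)
  rw [hypergeometricCoeff, hypergeometricCoeff']
  push_cast at h
  linear_combination ((n + i).choose n : ℤ) * h

/-- The induction goes by two because `n ↦ n + 2` moves the starting points down by exactly 12,
adding one factor at each end of both progressions. -/
theorem progressionProd_mul_factorial (n : ℕ) :
    12 ^ n * progressionProd (1 - 6 * n) n * progressionProd (5 - 6 * n) n *
      (((2 * n).factorial : ℤ) * (3 * n).factorial) = (6 * n).factorial * n.factorial := by
  induction n using Nat.twoStepInduction with
  | zero => simp [progressionProd]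
  | one => decide
  | more n ih _ =>
    have hx := progressionProd_add_twelve_mul (1 - 6 * (n + 2 : ℕ)) (n + 1)
    have hy := progressionProd_add_twelve_mul (5 - 6 * (n + 2 : ℕ)) (n + 1)
    rw [← hx, ← hy, progressionProd_succ, progressionProd_succ,
      show (1 - 6 * ((n + 2 : ℕ) : ℤ) + 12) = 1 - 6 * n by push_cast; ring,
      show (5 - 6 * ((n + 2 : ℕ) : ℤ) + 12) = 5 - 6 * n by push_cast; ring,
      show 2 * (n + 2) = 2 * n + 4 by ring, show 3 * (n + 2) = 3 * n + 6 by ring,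
      show 6 * (n + 2) = 6 * n + 12 by ring]
    simp only [Nat.factorial_succ]
    push_cast
    linear_combination 144 * (6 * n + 1) * (6 * n + 5) * (6 * n + 7) * (6 * n + 11) *
      ((2 * n + 1) * (2 * n + 2) * (2 * n + 3) * (2 * n + 4) *
      ((3 * n + 1) * (3 * n + 2) * (3 * n + 3) * (3 * n + 4) * (3 * n + 5) * (3 * n + 6) : ℤ)) * ih

theorem hypergeometricCoeff_zero (n : ℕ) :
    hypergeometricCoeff n 0 = (3 * n).choose n * (6 * n).choose (3 * n) := by
  have h1 := progressionQuot_mul (1 - 6 * n) (5 - 6 * n) n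
  have h2 := progressionProd_mul_factorial n
  have h3 := Nat.choose_mul_factorial_mul_factorial (show n ≤ 3 * n by omega)
  have h4 := Nat.choose_mul_factorial_mul_factorial (show 3 * n ≤ 6 * n by omega)
  rw [show 3 * n - n = 2 * n by omega] at h3
  rw [show 6 * n - 3 * n = 3 * n by omega] at h4
  have h3' := congrArg (Nat.cast : ℕ → ℤ) h3
  have h4' := congrArg (Nat.cast : ℕ → ℤ) h4
  push_cast at h3' h4'
  have hf (k : ℕ) : (k.factorial : ℤ) ≠ 0 := by exact_mod_cast k.factorial_ne_zero
  rw [hypergeometricCoeff, add_zero, Nat.choose_self, Nat.cast_one, one_mul]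
  refine mul_right_cancel₀ (mul_ne_zero (mul_ne_zero (pow_ne_zero 2 (hf n)) (hf (2 * n)))
    (hf (3 * n))) ?_
  rw [← h1] at h2
  linear_combination h2 - n.factorial * ((3 * n).factorial * (6 * n).choose (3 * n)) * h3' -
    n.factorial * h4'

/-! ### The spaces `QM w 0` and `QM w 1` and their dimension. -/

theorem mem_QM_zero {w : ℤ} {f : ℍ → ℂ} : f ∈ QM w 0 ↔ ∃ a : ModularForm 𝒮ℒ w, f = a := by
  constructor
  · intro hf
    induction hf using Submodule.span_induction with
    | mem F hF =>
      obtain ⟨l, hl, a, rfl⟩ := hF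
      obtain rfl : l = 0 := by omega
      exact ⟨ModularForm.mcast (by simp) a, by simp⟩
    | zero => exact ⟨0, rfl⟩
    | add F G _ _ hF hG =>
      obtain ⟨a, rfl⟩ := hF
      obtain ⟨b, rfl⟩ := hG
      exact ⟨a + b, rfl⟩
    | smul c F _ hF =>
      obtain ⟨a, rfl⟩ := hF
      exact ⟨c • a, rfl⟩
  · rintro ⟨a, rfl⟩
    exact Submodule.subset_span ⟨0, le_rfl, ModularForm.mcast (by simp) a, by simp⟩

/-- The map `(a, b) ↦ a + E₂ b`. -/
def depthOneMap (w : ℤ) : (ModularForm 𝒮ℒ w × ModularForm 𝒮ℒ (w - 2)) →ₗ[ℂ] (ℍ → ℂ) where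
  toFun x := x.1 + EisensteinSeries.E2 * x.2
  map_add' x y := by
    ext z
    simp
    ring
  map_smul' c x := by
    ext z
    simp
    ring

theorem range_depthOneMap (w : ℤ) : LinearMap.range (depthOneMap w) = QM w 1 := by
  refine le_antisymm ?_ (Submodule.span_le.mpr ?_)
  · rintro _ ⟨⟨a, b⟩, rfl⟩
    refine Submodule.add_mem _ (Submodule.subset_span ?_) (Submodule.subset_span ?_)
    · exact ⟨0, zero_le_one, ModularForm.mcast (by simp) a, by simp⟩
    · exact ⟨1, le_rfl, ModularForm.mcast (by simp) b, by simp⟩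
  · rintro _ ⟨l, hl, a, rfl⟩
    rcases Nat.le_one_iff_eq_zero_or_eq_one.mp hl with rfl | rfl
    · exact ⟨(ModularForm.mcast (by simp) a, 0), by ext z; simp [depthOneMap]⟩
    · exact ⟨(0, ModularForm.mcast (by simp) a), by ext z; simp [depthOneMap]⟩

theorem mem_QM_one {w : ℤ} {f : ℍ → ℂ} :
    f ∈ QM w 1 ↔ ∃ (a : ModularForm 𝒮ℒ w) (b : ModularForm 𝒮ℒ (w - 2)),
      f = a + EisensteinSeries.E2 * b := by
  rw [← range_depthOneMap]
  constructor
  · rintro ⟨⟨a, b⟩, rfl⟩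
    exact ⟨a, b, rfl⟩
  · rintro ⟨a, b, rfl⟩
    exact ⟨(a, b), rfl⟩

/-- Applying the slash action of `S` to `a + E₂ b = 0` changes it by a nonzero multiple of `b / z`,
so `b = 0` and then `a = 0`. -/
theorem depthOneMap_injective (w : ℤ) : Function.Injective (depthOneMap w) := by
  rw [injective_iff_map_eq_zero]
  rintro ⟨a, b⟩ hab
  have hz (z : ℍ) : a z + EisensteinSeries.E2 z * b z = 0 := congrFun hab z
  have ha := SlashInvariantForm.slash_action_eqn a.toSlashInvariantForm _ ⟨ModularGroup.S, rfl⟩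
  have hb := SlashInvariantForm.slash_action_eqn b.toSlashInvariantForm _ ⟨ModularGroup.S, rfl⟩
  have hE := E2_slash_action ModularGroup.S
  have hmul := ModularForm.mul_slash_SL2 2 (w - 2) ModularGroup.S EisensteinSeries.E2 b
  have hab' : (⇑a + EisensteinSeries.E2 * ⇑b : ℍ → ℂ) = 0 := hab
  have hslash := congrArg (fun f : ℍ → ℂ ↦ f ∣[w] ModularGroup.S) hab'
  have ha' : (⇑a) ∣[w] ModularGroup.S = ⇑a := ha
  have hb' : (⇑b) ∣[w - 2] ModularGroup.S = ⇑b := hb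
  rw [hE, hb', show 2 + (w - 2) = w by ring] at hmul
  simp only [SlashAction.add_slash, ha', hmul, SlashAction.zero_slash] at hslash
  have hb0 : b = 0 := by
    ext z
    have h1 := congrFun hslash z
    have h2 := hz z
    have hπ : (Real.pi : ℂ) ≠ 0 := by exact_mod_cast Real.pi_ne_zero
    have hzz := ne_zero z
    simp only [Pi.add_apply, Pi.mul_apply, Pi.sub_apply, Pi.smul_apply, smul_eq_mul, D2_S,
      riemannZeta_two, Pi.zero_apply] at h1
    have h3 : (1 / (2 * (Real.pi ^ 2 / 6)) * (2 * Real.pi * Complex.I / z) : ℂ) * b z = 0 := by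
      linear_combination h2 - h1
    rcases mul_eq_zero.mp h3 with h4 | h4
    · simp [hπ, hzz, Complex.I_ne_zero] at h4
    · exact h4
  subst hb0
  have ha0 : a = 0 := by
    ext z
    simpa using hz z
  rw [ha0]
  rfl

theorem finrank_modularForm {k : ℕ} (hk : Even k) :
    Module.finrank ℂ (ModularForm 𝒮ℒ (k : ℤ)) = if k ≡ 2 [MOD 12] then k / 12 else k / 12 + 1 := by
  have h := dimension_level_one k hk
  rw [Module.finrank, h]
  split_ifs <;> simp

theorem finrank_QM_one {k : ℕ} (hk : Even k) : Module.finrank ℂ (QM k 1) = k / 6 + 1 := by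
  rw [← range_depthOneMap, LinearMap.finrank_range_of_inj (depthOneMap_injective _),
    Module.finrank_prod, finrank_modularForm hk]
  have hk2 : k % 2 = 0 := Nat.even_iff.mp hk
  rcases Nat.eq_zero_or_pos k with rfl | hpos
  · have : Module.finrank ℂ (ModularForm 𝒮ℒ (((0 : ℕ) : ℤ) - 2)) = 0 := by
      rw [Module.finrank, levelOne_neg_weight_rank_zero (by norm_num)]
      simp
    rw [this]
    simp [Nat.ModEq]
  · obtain ⟨j, rfl⟩ : ∃ j, k = j + 2 := ⟨k - 2, by omega⟩
    rw [show ((j + 2 : ℕ) : ℤ) - 2 = (j : ℤ) by push_cast; ring,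
      finrank_modularForm (Nat.even_iff.mpr (by omega))]
    by_cases h1 : j + 2 ≡ 2 [MOD 12] <;> by_cases h2 : j ≡ 2 [MOD 12] <;>
      simp only [h1, h2, if_true, if_false] <;> simp only [Nat.ModEq] at h1 h2 <;> omega

theorem isHolomorphicInQ_of_mem_QM_one {w : ℤ} {f : ℍ → ℂ} (hf : f ∈ QM w 1) :
    IsHolomorphicInQ f := by
  obtain ⟨a, b, rfl⟩ := mem_QM_one.mp hf
  exact (IsHolomorphicInQ.modularForm a).add (IsHolomorphicInQ.E2.mul (.modularForm b))

theorem isQuasimodular_of_mem_QM_one {w : ℤ} {f : ℍ → ℂ} (hf : f ∈ QM w 1) :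
    IsQuasimodular w (qExpansion 1 f) := by
  obtain ⟨a, b, rfl⟩ := mem_QM_one.mp hf
  have ha := IsHolomorphicInQ.modularForm a
  have hb := IsHolomorphicInQ.modularForm b
  have h2 := IsHolomorphicInQ.E2
  exact ⟨_, _, ⟨a, rfl⟩, ⟨b, rfl⟩, by
    rw [qExpansion_add ha.analyticAt (h2.mul hb).analyticAt, qExpansion_mul h2.analyticAt
      hb.analyticAt, e2]⟩

/-- The `q`-expansion as a linear map on quasimodular forms of depth at most one. -/
def qExpansionLinearMap (w : ℤ) : QM w 1 →ₗ[ℂ] PowerSeries ℂ where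
  toFun f := qExpansion 1 (f : ℍ → ℂ)
  map_add' f g := qExpansion_add (isHolomorphicInQ_of_mem_QM_one f.2).analyticAt
    (isHolomorphicInQ_of_mem_QM_one g.2).analyticAt
  map_smul' c f := qExpansion_smul (isHolomorphicInQ_of_mem_QM_one f.2).analyticAt c

/-! ### Existence and uniqueness of extremal forms. -/

/-- The function `f` is a quasimodular form of weight `k` and depth at most one whose Fourier
expansion is `q ^ n + O(q ^ (n + 1))` with `n = k / 6`. -/
structure IsExtremal (k : ℕ) (f : ℍ → ℂ) : Prop where
  mem : f ∈ QM k 1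
  dvd : PowerSeries.X ^ (k / 6) ∣ qExpansion 1 f
  coeff_eq_one : (qExpansion 1 f).coeff (k / 6) = 1

theorem eq_zero_of_coeff_eq_zero {k : ℕ} {f : ℍ → ℂ} (hf : f ∈ QM k 1)
    (h : ∀ i ≤ k / 6, (qExpansion 1 f).coeff i = 0) : f = 0 := by
  have hq := isHolomorphicInQ_of_mem_QM_one hf
  refine (qExpansion_eq_zero_iff one_pos hq.periodic hq.mdiff hq.bdd).mp ?_
  exact (isQuasimodular_of_mem_QM_one hf).eq_zero (by simpa using h)

/-- The first `k / 6 + 1` coefficients determine a form, and the dimension equals their number. So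
they can be prescribed freely. -/
theorem exists_isExtremal {k : ℕ} (hk : Even k) : ∃ f, IsExtremal k f := by
  let L : QM k 1 →ₗ[ℂ] (Fin (k / 6 + 1) → ℂ) :=
    (LinearMap.pi fun i : Fin (k / 6 + 1) ↦ PowerSeries.coeff (i : ℕ)) ∘ₗ qExpansionLinearMap k
  have hL (f : QM k 1) (i : Fin (k / 6 + 1)) : L f i = (qExpansion 1 (f : ℍ → ℂ)).coeff i := rfl
  have hinj : Function.Injective L := by
    rw [injective_iff_map_eq_zero]
    intro f hf
    refine Subtype.ext (eq_zero_of_coeff_eq_zero f.2 fun i hi ↦ ?_)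
    rw [← hL f ⟨i, Nat.lt_succ_of_le hi⟩, hf]
    rfl
  have : FiniteDimensional ℂ (QM k 1) :=
    Module.finite_of_finrank_pos (by rw [finrank_QM_one hk]; omega)
  have hsurj := (LinearMap.injective_iff_surjective_of_finrank_eq_finrank
    (by rw [finrank_QM_one hk, Module.finrank_fin_fun])).mp hinj
  obtain ⟨f, hf⟩ := hsurj (Pi.single (Fin.last _) 1)
  refine ⟨f, f.2, PowerSeries.X_pow_dvd_iff.mpr fun i hi ↦ ?_, ?_⟩
  · rw [← hL f ⟨i, by omega⟩, hf, Pi.single_eq_of_ne]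
    exact fun h ↦ hi.ne (congrArg Fin.val h)
  · have := congrFun hf (Fin.last _)
    rwa [Pi.single_eq_same] at this

theorem IsExtremal.eq {k : ℕ} {f g : ℍ → ℂ} (hf : IsExtremal k f) (hg : IsExtremal k g) :
    f = g := by
  refine sub_eq_zero.mp (eq_zero_of_coeff_eq_zero (sub_mem hf.mem hg.mem) fun i hi ↦ ?_)
  rw [qExpansion_sub (isHolomorphicInQ_of_mem_QM_one hf.mem).analyticAt
    (isHolomorphicInQ_of_mem_QM_one hg.mem).analyticAt, map_sub]
  rcases hi.lt_or_eq with hi | rfl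
  · rw [PowerSeries.X_pow_dvd_iff.mp hf.dvd i hi, PowerSeries.X_pow_dvd_iff.mp hg.dvd i hi,
      sub_zero]
  · rw [hf.coeff_eq_one, hg.coeff_eq_one, sub_self]

theorem isExtremal_one : IsExtremal 0 1 where
  mem := mem_QM_one.mpr ⟨ModularForm.mcast (by simp) (1 : ModularForm 𝒮ℒ 0), 0, by
    ext z
    simp⟩
  dvd := by simp
  coeff_eq_one := by simp [qExpansion_one]

theorem isExtremal_E₄ : IsExtremal 4 E₄ where
  mem := mem_QM_one.mpr ⟨E₄, 0, by simp⟩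
  dvd := by simp
  coeff_eq_one := coeff_e4 0

theorem isNormalizedExtremal_iff {k : ℕ} (hk : Even k) (h0 : k ≠ 0) (h4 : k ≠ 4) {f : ℍ → ℂ} :
    IsNormalizedExtremal k 1 f ↔ IsExtremal k f := by
  have hk2 : k % 2 = 0 := Nat.even_iff.mp hk
  have hfin := finrank_QM_one hk
  constructor
  · intro h
    have hlead := h.leading
    have hord := h.order_add_one
    rw [hfin] at hlead hord
    refine ⟨h.mem, PowerSeries.X_pow_dvd_iff.mpr fun i hi ↦ ?_, hlead⟩
    refine PowerSeries.coeff_of_lt_order _ ?_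
    have : (qExpansion 1 f).order = ((k / 6 : ℕ) : ℕ∞) := by
      push_cast at hord
      exact ENat.add_left_injective_of_ne_top ENat.one_ne_top hord
    rw [this]
    exact_mod_cast hi
  · intro h
    refine ⟨h.mem, fun s hs hmem ↦ ?_, ?_, ?_⟩
    · obtain rfl : s = 0 := by omega
      obtain ⟨a, ha⟩ := mem_QM_zero.mp hmem
      have hq : qExpansion 1 f ≠ 0 := fun h' ↦ by
        have := h.coeff_eq_one
        simp [h'] at this
      by_cases hk2 : k = 2
      · subst hk2
        have ha0 : a = 0 := rank_zero_iff_forall_zero.mp levelOne_weight_two_rank_zero a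
        rw [ha, ha0] at hq
        exact hq (qExpansion_zero 1)
      · refine hq (IsModular.eq_zero (k := k) ⟨a, by rw [ha]⟩ fun i hi ↦ ?_)
        rw [Int.toNat_natCast] at hi
        exact PowerSeries.X_pow_dvd_iff.mp h.dvd i (by omega)
    · rw [hfin, PowerSeries.order_eq_nat.mpr ⟨?_, PowerSeries.X_pow_dvd_iff.mp h.dvd⟩]
      · push_cast
        rfl
      · rw [h.coeff_eq_one]
        exact one_ne_zero
    · rw [hfin]
      exact h.coeff_eq_one

theorem isG_iff {k : ℕ} (hk : Even k) {f : ℍ → ℂ} : IsG k f ↔ IsExtremal k f := by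
  rw [IsG]
  split_ifs with h0 h4
  · obtain rfl : k = 0 := by exact_mod_cast h0
    exact ⟨fun h ↦ h ▸ isExtremal_one, fun h ↦ h.eq isExtremal_one⟩
  · obtain rfl : k = 4 := by exact_mod_cast h4
    exact ⟨fun h ↦ h ▸ isExtremal_E₄, fun h ↦ h.eq isExtremal_E₄⟩
  · exact isNormalizedExtremal_iff hk (by exact_mod_cast h0) (by exact_mod_cast h4)

theorem existsUnique_isG {k : ℕ} (hk : Even k) : ∃! f, IsG k f := by
  obtain ⟨f, hf⟩ := exists_isExtremal hk
  exact ⟨f, (isG_iff hk).mpr hf, fun g hg ↦ ((isG_iff hk).mp hg).eq hf⟩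

theorem IsExtremal.E₄_mul {n : ℕ} {f : ℍ → ℂ} (hf : IsExtremal (6 * n) f) :
    IsExtremal (6 * n + 4) ((E₄ : ℍ → ℂ) * f) := by
  have hq := isHolomorphicInQ_of_mem_QM_one hf.mem
  have h4 := IsHolomorphicInQ.modularForm E₄
  have hdvd := hf.dvd
  have hone := hf.coeff_eq_one
  rw [show 6 * n / 6 = n by omega] at hdvd hone
  refine ⟨?_, ?_, ?_⟩
  · obtain ⟨a, b, rfl⟩ := mem_QM_one.mp hf.mem
    refine mem_QM_one.mpr ⟨ModularForm.mcast (by push_cast; ring) (E₄.mul a),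
      ModularForm.mcast (by push_cast; ring) (E₄.mul b), ?_⟩
    ext z
    simp
    ring
  all_goals
    rw [show (6 * n + 4) / 6 = n by omega, qExpansion_mul h4.analyticAt hq.analyticAt]
  · exact hdvd.mul_left _
  · rw [coeff_mul_of_X_pow_dvd _ hdvd, hone, mul_one]
    exact constantCoeff_e4

/-! ### Integrality for the extremal forms of weight `6n`, `6n + 2` and `6n + 4`. -/

theorem X_pow_dvd_smul {n : ℕ} {s : PowerSeries ℂ} (c : ℂ) (h : PowerSeries.X ^ n ∣ s) :
    PowerSeries.X ^ n ∣ c • s := by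
  obtain ⟨g, rfl⟩ := h
  exact ⟨c • g, (mul_smul_comm _ _ _).symm⟩

/-- The binomial product `(3n choose n) (6n choose 3n)`. -/
abbrev binomialProd (n : ℕ) : ℤ := (3 * n).choose n * (6 * n).choose (3 * n)

theorem IsExtremal.hasIntegralFourierCoeffs {n : ℕ} {f : ℍ → ℂ} (hf : IsExtremal (6 * n) f) :
    HasIntegralFourierCoeffs (((binomialProd n : ℤ) : ℂ) • f) := by
  intro k
  have hq := isHolomorphicInQ_of_mem_QM_one hf.mem
  have hdvd := hf.dvd
  have hone := hf.coeff_eq_one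
  rw [show 6 * n / 6 = n by omega] at hdvd hone
  rw [qExpansion_smul hq.analyticAt]
  refine exists_coeff_eq_intCast (hypergeometricCoeff_succ n)
    (((isQuasimodular_of_mem_QM_one hf.mem).cast (by push_cast; ring)).smul _) ?_ ?_ k
  · exact X_pow_dvd_smul _ hdvd
  · rw [PowerSeries.coeff_smul, hone, hypergeometricCoeff_zero, smul_eq_mul, mul_one]

theorem IsExtremal.hasIntegralFourierCoeffs_add_two {n : ℕ} {f : ℍ → ℂ}
    (hf : IsExtremal (6 * n + 2) f) {c : ℂ} (hc : (6 * n - 1) * c = (6 * n + 1) * binomialProd n) :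
    HasIntegralFourierCoeffs (c • f) := by
  intro k
  have hq := isHolomorphicInQ_of_mem_QM_one hf.mem
  have hdvd := hf.dvd
  have hone := hf.coeff_eq_one
  rw [show (6 * n + 2) / 6 = n by omega] at hdvd hone
  obtain ⟨g, hg⟩ := exists_isExtremal (k := 6 * n) ⟨3 * n, by ring⟩
  have hgdvd := hg.dvd
  have hgone := hg.coeff_eq_one
  rw [show 6 * n / 6 = n by omega] at hgdvd hgone
  have hgm := ((isQuasimodular_of_mem_QM_one hg.mem).cast
    (show ((6 * n : ℕ) : ℤ) = 6 * n by push_cast; ring)).smul (binomialProd n : ℂ)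
  have hgd : PowerSeries.X ^ n ∣ ((binomialProd n : ℤ) : ℂ) • qExpansion 1 g :=
    X_pow_dvd_smul _ hgdvd
  have hg1 : (((binomialProd n : ℤ) : ℂ) • qExpansion 1 g).coeff n = (binomialProd n : ℤ) := by
    rw [PowerSeries.coeff_smul, hgone, smul_eq_mul, mul_one]
  have hfd : PowerSeries.X ^ n ∣ c • qExpansion 1 f := X_pow_dvd_smul _ hdvd
  rw [qExpansion_smul hq.analyticAt]
  refine exists_coeff_eq_intCast_of_serreTheta (hypergeometricCoeff_succ n)
    (hypergeometricCoeff'_mul n) hgm hgd (by rw [hg1, hypergeometricCoeff_zero]) ?_ k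
  have hfm := (((isQuasimodular_of_mem_QM_one hf.mem).cast
    (show ((6 * n + 2 : ℕ) : ℤ) = 6 * n + 2 by push_cast; ring)).smul c).intCast_mul (6 * n - 1)
  -- Both sides have weight `6n + 2` and vanish below order `n`. At order `n` the Serre derivative
  -- contributes `12n - (6n - 1) = 6n + 1`, the factor in `hc`.
  refine sub_eq_zero.mp ((hfm.sub hgm.serreTheta).eq_zero fun i hi ↦ ?_)
  have hi' : i ≤ n := by omega
  have hfd' : PowerSeries.X ^ n ∣ ((6 * n - 1 : ℤ) : PowerSeries ℂ) * (c • qExpansion 1 f) :=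
    hfd.mul_left _
  rcases hi'.lt_or_eq with hi | rfl
  · exact PowerSeries.X_pow_dvd_iff.mp (dvd_sub hfd' (X_pow_dvd_serreTheta _ hgd)) i hi
  · rw [map_sub, coeff_serreTheta _ hgd, hg1, coeff_mul_of_X_pow_dvd _ hfd, map_intCast,
      PowerSeries.coeff_smul, hone, smul_eq_mul, mul_one]
    push_cast at hc ⊢
    linear_combination hc

theorem HasIntegralFourierCoeffs.E₄_mul {c : ℂ} {f : ℍ → ℂ} (hf : IsHolomorphicInQ f)
    (h : HasIntegralFourierCoeffs (c • f)) :
    HasIntegralFourierCoeffs (c • ((E₄ : ℍ → ℂ) * f)) := by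
  intro n
  choose b hb using h
  have h4 := IsHolomorphicInQ.modularForm E₄
  rw [← mul_smul_comm, qExpansion_mul h4.analyticAt (hf.smul c).analyticAt]
  refine coeff_of_mem_integralSeries (mul_mem e4_mem_integralSeries ⟨PowerSeries.mk b, ?_⟩) n
  ext k
  simp [hb]

end Quasimodular

end

theorem mainTheorem3 (m : ℕ) :
    -- the forms in question exist and are unique
    (∀ a ∈ ({0, 2, 4, 6, 8, 10} : Set ℤ), ∃! G : ℍ → ℂ, Quasimodular.IsG (12 * m + a) G) ∧
    -- integrality of the multiples of the forms of weight congruent to 0, 2, 6, 8 mod 12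
    (∀ G : ℍ → ℂ, Quasimodular.IsG (12 * m) G →
      Quasimodular.HasIntegralFourierCoeffs ((Quasimodular.N0div m : ℂ) • G)) ∧
    (∀ G : ℍ → ℂ, Quasimodular.IsG (12 * m + 2) G →
      Quasimodular.HasIntegralFourierCoeffs ((Quasimodular.N2div m : ℂ) • G)) ∧
    (∀ G : ℍ → ℂ, Quasimodular.IsG (12 * m + 6) G →
      Quasimodular.HasIntegralFourierCoeffs
        (((Quasimodular.N6 m / (12 * (2 * m + 1)) : ℚ) : ℂ) • G)) ∧
    (∀ G : ℍ → ℂ, Quasimodular.IsG (12 * m + 8) G →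
      Quasimodular.HasIntegralFourierCoeffs
        (((Quasimodular.N8 m / (12 * (2 * m + 1)) : ℚ) : ℂ) • G)) ∧
    -- the forms of weight congruent to 4, 10 mod 12
    (∀ G H : ℍ → ℂ, Quasimodular.IsG (12 * m) G → Quasimodular.IsG (12 * m + 4) H →
      H = (ModularForm.E₄ : ℍ → ℂ) * G) ∧
    (∀ G H : ℍ → ℂ, Quasimodular.IsG (12 * m + 6) G → Quasimodular.IsG (12 * m + 10) H →
      H = (ModularForm.E₄ : ℍ → ℂ) * G) ∧
    (∀ G : ℍ → ℂ, Quasimodular.IsG (12 * m + 4) G →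
      Quasimodular.HasIntegralFourierCoeffs ((Quasimodular.N0div m : ℂ) • G)) ∧
    (∀ G : ℍ → ℂ, Quasimodular.IsG (12 * m + 10) G →
      Quasimodular.HasIntegralFourierCoeffs
        (((Quasimodular.N6 m / (12 * (2 * m + 1)) : ℚ) : ℂ) • G)) := by
  open Quasimodular in
  have hG {k : ℕ} {w : ℤ} (hw : w = k) (hk : k % 2 = 0) {f : ℍ → ℂ} (h : IsG w f) :
      IsExtremal k f := (isG_iff (Nat.even_iff.mpr hk)).mp (hw ▸ h)
  have hN0 : (N0div m : ℂ) = (binomialProd (2 * m) : ℤ) := by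
    rw [N0div, binomialProd, show 3 * (2 * m) = 6 * m by ring, show 6 * (2 * m) = 12 * m by ring]
    push_cast
    rfl
  have hN6' : N6 m / (12 * (2 * m + 1)) = (binomialProd (2 * m + 1) : ℤ) := by
    have h : (12 * (2 * m + 1) : ℚ) ≠ 0 := by positivity
    rw [N6, binomialProd, show 3 * (2 * m + 1) = 6 * m + 3 by ring,
      show 6 * (2 * m + 1) = 12 * m + 6 by ring, div_eq_iff h]
    push_cast
    ring
  have hN6 : ((N6 m / (12 * (2 * m + 1)) : ℚ) : ℂ) = (binomialProd (2 * m + 1) : ℤ) := by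
    rw [hN6']
    push_cast
    rfl
  have h0 {f : ℍ → ℂ} (h : IsG (12 * m) f) : IsExtremal (6 * (2 * m)) f :=
    hG (by push_cast; ring) (by omega) h
  have h6 {f : ℍ → ℂ} (h : IsG (12 * m + 6) f) : IsExtremal (6 * (2 * m + 1)) f :=
    hG (by push_cast; ring) (by omega) h
  have h4 {f : ℍ → ℂ} (h : IsG (12 * m + 4) f) : IsExtremal (6 * (2 * m) + 4) f :=
    hG (by push_cast; ring) (by omega) h
  have h10 {f : ℍ → ℂ} (h : IsG (12 * m + 10) f) : IsExtremal (6 * (2 * m + 1) + 4) f :=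
    hG (by push_cast; ring) (by omega) h
  refine ⟨fun a ha ↦ ?_, fun G h ↦ ?_, fun G h ↦ ?_, fun G h ↦ ?_, fun G h ↦ ?_, fun G H hG hH ↦ ?_,
    fun G H hG hH ↦ ?_, fun G h ↦ ?_, fun G h ↦ ?_⟩
  · obtain ⟨j, rfl, hj⟩ : ∃ j : ℕ, a = j ∧ j % 2 = 0 := by
      simp only [Set.mem_insert_iff, Set.mem_singleton_iff] at ha
      exact ⟨a.toNat, by omega, by omega⟩
    have := existsUnique_isG (k := 12 * m + j) (Nat.even_iff.mpr (by omega))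
    push_cast at this
    exact this
  · rw [hN0]
    exact (h0 h).hasIntegralFourierCoeffs
  · refine IsExtremal.hasIntegralFourierCoeffs_add_two (n := 2 * m)
      (hG (by push_cast; ring) (by omega) h) ?_
    have hm : (12 * m - 1 : ℚ) ≠ 0 := by
      have : (12 * m - 1 : ℤ) ≠ 0 := by omega
      exact_mod_cast this
    have key : ((6 * (2 * m : ℕ) - 1) * N2div m : ℚ) = (6 * (2 * m : ℕ) + 1) * N0div m := by
      rw [N2div, N0div]
      push_cast
      rw [show (6 * (2 * m) - 1 : ℚ) = 12 * m - 1 by ring, ← mul_assoc, mul_div_cancel₀ _ hm]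
      ring
    rw [← hN0]
    exact_mod_cast key
  · rw [hN6]
    exact (h6 h).hasIntegralFourierCoeffs
  · refine IsExtremal.hasIntegralFourierCoeffs_add_two (n := 2 * m + 1)
      (hG (by push_cast; ring) (by omega) h) ?_
    rw [← hN6]
    have hm : (12 * m + 5 : ℚ) ≠ 0 := by positivity
    have hm' : (12 * (2 * m + 1) : ℚ) ≠ 0 := by positivity
    have key : ((6 * (2 * m + 1 : ℕ) - 1) * (N8 m / (12 * (2 * m + 1))) : ℚ) =
        (6 * (2 * m + 1 : ℕ) + 1) * (N6 m / (12 * (2 * m + 1))) := by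
      rw [N8]
      push_cast
      field_simp
      ring
    exact_mod_cast key
  · exact (h4 hH).eq (h0 hG).E₄_mul
  · exact (h10 hH).eq (h6 hG).E₄_mul
  · obtain ⟨g, hg⟩ := exists_isExtremal (k := 6 * (2 * m)) (Nat.even_iff.mpr (by omega))
    rw [(h4 h).eq hg.E₄_mul, hN0]
    exact hg.hasIntegralFourierCoeffs.E₄_mul (isHolomorphicInQ_of_mem_QM_one hg.mem)
  · obtain ⟨g, hg⟩ := exists_isExtremal (k := 6 * (2 * m + 1)) (Nat.even_iff.mpr (by omega))
    rw [(h10 h).eq hg.E₄_mul, hN6]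
    exact hg.hasIntegralFourierCoeffs.E₄_mul (isHolomorphicInQ_of_mem_QM_one hg.mem)
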